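/- **Setting.** Let $M$ be a smooth compact Riemannian manifold of dimension $n$, with or without boundary, with smooth metric $g$ and volume measure $d\mathrm{vol}_M$. A *reference cell* is a box $Y=\prod_i[a_i,b_i]\subset\mathbb R^n$, $a_i<b_i$, with edge vectors $\ell_ie_i$, $\ell_i=b_i-a_i$. A function on $\mathbb R^n$ is *$Y$-periodic* if it is invariant under translation by each $\ell_ie_i$, and $H^1_\#(Y)$ is the closure of the smooth $Y$-periodic functions in $H^1(Y)$. A *material property* for $Y$ is a continuous $Y$-periodic function $D$ with $0<d_0\le D\le d_1$ for some constants $d_0,d_1$. A finite atlas $\mathcal A=\{\phi_\alpha:U_\alpha\to V_\alpha\subset\mathbb R^n\}$ of $M$ *satisfies the UC-criterion* for $Y$ if for all $\alpha,\beta$ with $U_\alpha\cap U_\beta\ne\emptyset$ and all scales $\varepsilon\in S$ there is $k(\varepsilon)\in\mathbb Z^n$ with $\phi_\alpha=\phi_\beta+\varepsilon\sum_ik_i(\varepsilon)\ell_ie_i$ on $U_\alpha\cap U_\beta$. Here $S\subset(0,\infty)$ is a fixed set of scales that accumulates at $0$, for instance $S=(0,\infty)$. **Limit problem.** Let $\mathcal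 A$ be such an atlas, with cell $Y$ and material property $D$. For $x\in M$ and a chart $\phi_\alpha=(x^1,\dots,x^n)$ of $\mathcal A$ around $x$, let $g_{ij}(x)=g(\tfrac{\partial}{\partial x^i},\tfrac{\partial}{\partial x^j})$, let $g_Y^{(x)}=\sum_{i,j} g_{ij}(x)\,dy^i\otimes dy^j$ be the corresponding constant metric on $Y$, with gradient $\nabla_Y^{(x)}$, and let $w_i(x)\in H^1_\#(Y)/\mathbb R$ be the weak solution of the cell problem $$\int_Y D\,g_Y^{(x)}\big(\nabla_Y^{(x)}w_i,\nabla_Y^{(x)}\varphi\big)\,dy=-\int_Y D\,g_Y^{(x)}\big(\tfrac{\partial}{\partial y^i},\nabla_Y^{(x)}\varphi\big)\,dy\qquad\forall\varphi\in H^1_\#(Y).$$ The effective operator $B$ is given by $B\frac{\partial}{\partial x^i}=\sum_kB_i^k\frac{\partial}{\partial x^k}$ with $$B_i^k(x)=\frac1{|Y|}\int_Y D(y)\Big(\delta_i^k+\sum_jg^{kj}(x)\frac{\partial w_i}{\partial y^j}(x,y)\Big)dy .$$ For a constant $c\ge0$ and $f\in L^2(M)$ the limit problem is: find $u\in H^1_0(M)$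 with $$-\operatorname{div}_M(B\nabla_Mu)+cu=f\ \text{ in }M,\qquad u=0\ \text{ on }\partial M,$$ that is, $\int_Mg(B\nabla_Mu,\nabla_M\varphi)\,d\mathrm{vol}_M+\int_Mcu\varphi\,d\mathrm{vol}_M=\int_Mf\varphi\,d\mathrm{vol}_M$ for all $\varphi\in H^1_0(M)$. **Theorem 4.2.** Let $\mathcal A^1=\{\phi^1_\alpha\}$ and $\mathcal A^2=\{\phi^2_\beta\}$ be two finite atlases of $M$ that satisfy the UC-criterion for reference cells $Y$ and $Z$ respectively, and let $D_Y$, $D_Z$ be material properties for $Y$ and $Z$. Suppose that there is one linear map $F:\mathbb R^n\to\mathbb R^n$ such that, whenever $U^1_\alpha\cap U^2_\beta\neq\emptyset$, the coordinate transformation $\phi^2_\beta\circ(\phi^1_\alpha)^{-1}$ is the restriction of $F$ (or, more generally, of $F+t_{\alpha\beta}$ with a constant vector $t_{\alpha\beta}\in\mathbb R^n$). Suppose moreover that $F$ maps $Y$ bijectively onto $Z$ and that $D_Z=(F|_Y)_*D_Y$, i.e. $D_Z(F(y))=D_Y(y)$ for $y\in Y$. Then the limit problem is the same for both atlases. That is,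 at every $x\in M$ each of the triples $(\mathcal A^1,Y,D_Y)$ and $(\mathcal A^2,Z,D_Z)$ determines exactly one effective operator on $T_xM$, independently of the choice of the chart around $x$, and these two operators coincide; and for all $c\ge0$ and $f\in L^2(M)$ a function $u$ solves the limit problem of $(\mathcal A^1,Y,D_Y)$ if and only if it solves that of $(\mathcal A^2,Z,D_Z)$. -/

import Mathlib

open Set Filter Topology MeasureTheory Bundle
open scoped Manifold ContDiff ENNReal Matrix

noncomputable section

namespace Homogenization

/-- Coordinate space `ℝⁿ`, with its Lebesgue measure `volume`. -/
abbrev Coord (n : ℕ) : Type := EuclideanSpace ℝ (Fin n)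

/-! ### Reference cells and periodic functions -/

/-- A rectangular reference cell `∏ᵢ [lo i, up i]` in `ℝⁿ` with sides of positive length. -/
structure Cell (n : ℕ) where
  lo : Fin n → ℝ
  up : Fin n → ℝ
  lo_lt_up : ∀ i, lo i < up i

namespace Cell

variable {n : ℕ}

/-- The points of the cell. -/
def carrier (Y : Cell n) : Set (Coord n) := {y | ∀ i, y i ∈ Set.Icc (Y.lo i) (Y.up i)}

/-- The `i`-th edge vector `(up i - lo i) eᵢ`. These vectors generate the period lattice. -/
def edge (Y : Cell n) (i : Fin n) : Coord n := EuclideanSpace.single i (Y.up i - Y.lo i)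

/-- `Y`-periodicity of a function on `ℝⁿ`. -/
def IsPeriodic (Y : Cell n) (h : Coord n → ℝ) : Prop := ∀ y i, h (y + Y.edge i) = h y

/-- A material property: a continuous `Y`-periodic function between two positive constants. -/
def IsMaterial (Y : Cell n) (D : Coord n → ℝ) : Prop :=
  Continuous D ∧ Y.IsPeriodic D ∧ ∃ d₀ d₁ : ℝ, 0 < d₀ ∧ ∀ y, d₀ ≤ D y ∧ D y ≤ d₁

/-- Lebesgue measure on the cell. -/
def measure (Y : Cell n) : Measure (Coord n) := volume.restrict Y.carrier

/-- `w` belongs to `H¹_#(Y)`, the closure of the smooth `Y`-periodic functions in `H¹(Y)`, and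
`p = (∂w/∂y¹, …, ∂w/∂yⁿ)` is its weak Euclidean gradient. Only the values on `Y` matter. -/
def MemH1Per (Y : Cell n) (w : Coord n → ℝ) (p : Coord n → Coord n) : Prop :=
  MemLp w 2 Y.measure ∧ MemLp p 2 Y.measure ∧
  ∃ φ : ℕ → Coord n → ℝ, (∀ k, ContDiff ℝ ∞ (φ k) ∧ Y.IsPeriodic (φ k)) ∧
    Tendsto (fun k => eLpNorm (fun y => φ k y - w y) 2 Y.measure) atTop (𝓝 0) ∧
    Tendsto (fun k => eLpNorm (fun y => gradient (φ k) y - p y) 2 Y.measure) atTop (𝓝 0)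

/-- The scalar product `∑ G_{ij} vⁱ wʲ` of the constant metric `∑ G_{ij} dyⁱ ⊗ dyʲ`. -/
def inner (G : Matrix (Fin n) (Fin n) ℝ) (v w : Fin n → ℝ) : ℝ := ∑ i, ∑ j, G i j * v i * w j

/-- The gradient with respect to the metric `G` of a function with partial derivatives `p`:
its `k`-th component is `∑ⱼ G^{kj} ∂w/∂yʲ`. -/
def grad (G : Matrix (Fin n) (Fin n) ℝ) (p : Coord n) (k : Fin n) : ℝ := ∑ j, G⁻¹ k j * p j

/-- `w ∈ H¹_#(Y)`, with partial derivatives `p`, is a weak solution of the `i`-th cell problem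
`-div (D ∇w) = div (D ∂/∂yⁱ)` for the constant metric `G`. -/
def IsCellSolution (Y : Cell n) (D : Coord n → ℝ) (G : Matrix (Fin n) (Fin n) ℝ) (i : Fin n)
    (w : Coord n → ℝ) (p : Coord n → Coord n) : Prop :=
  Y.MemH1Per w p ∧ ∀ φ q, Y.MemH1Per φ q →
    ∫ y in Y.carrier, D y * inner G (grad G (p y)) (grad G (q y)) =
      - ∫ y in Y.carrier, D y * inner G (Pi.single i 1) (grad G (q y))

/-- `B_i^k = |Y|⁻¹ ∫_Y D (δ_i^k + A_i^k) dy` with `A_i^k = ∑ⱼ G^{kj} ∂wᵢ/∂yʲ`, where `p i` holds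
the partial derivatives of `wᵢ`. -/
def effectiveCoeff (Y : Cell n) (D : Coord n → ℝ) (G : Matrix (Fin n) (Fin n) ℝ)
    (p : Fin n → Coord n → Coord n) (k i : Fin n) : ℝ :=
  (volume.real Y.carrier)⁻¹ *
    ∫ y in Y.carrier, D y * ((if k = i then 1 else 0) + grad G (p i y) k)

end Cell

section Manifold

variable {n : ℕ} {H : Type*} [TopologicalSpace H] (I : ModelWithCorners ℝ (Coord n) H)
  (M : Type*) [TopologicalSpace M] [ChartedSpace H M]

/-! ### Atlases -/

/-- An atlas of `M`, indexed by `ι`: diffeomorphisms `φ_α` from open sets `U_α`, which cover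
`M`, onto subsets `V_α` of `ℝⁿ`. If `M` has a boundary, then `V_α` need not be open. -/
structure Atlas (ι : Type*) where
  chart : ι → PartialEquiv M (Coord n)
  isOpen_source : ∀ α, IsOpen (chart α).source
  smooth : ∀ α, ContMDiffOn I 𝓘(ℝ, Coord n) ∞ (chart α) (chart α).source
  smooth_symm : ∀ α, ContMDiffOn 𝓘(ℝ, Coord n) I ∞ (chart α).symm (chart α).target
  cover : ∀ x, ∃ α, x ∈ (chart α).source

variable {I M}

/-- Compatibility with unfolding for the cell `Y` and the scales `ε ∈ S`: on overlaps, charts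
differ by `ε` times a vector of the period lattice (`ℤⁿ` for the unit cell). -/
def Atlas.IsUC {ι : Type*} (𝒜 : Atlas I M ι) (Y : Cell n) (S : Set ℝ) : Prop :=
  ∀ α β, ((𝒜.chart α).source ∩ (𝒜.chart β).source).Nonempty → ∀ ε ∈ S,
    ∃ k : Fin n → ℤ, ∀ x ∈ (𝒜.chart α).source ∩ (𝒜.chart β).source,
      𝒜.chart α x = 𝒜.chart β x + ε • ∑ i, (k i : ℝ) • Y.edge i

/-- The local basis vector `∂/∂xⁱ = (dφ_x)⁻¹ eᵢ` at `x` of a chart `φ`. -/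
def basisVec (I : ModelWithCorners ℝ (Coord n) H) (φ : M → Coord n) (x : M) (i : Fin n) :
    TangentSpace I x :=
  (mfderiv I 𝓘(ℝ, Coord n) φ x).inverse (EuclideanSpace.single i (1 : ℝ) : Coord n)

variable [IsManifold I ∞ M]
  (g : ContMDiffRiemannianMetric I ∞ (Coord n) (fun x : M => TangentSpace I x))

/-- The metric coefficients `g_{ij}(x)` in a chart `φ`. -/
def gram (φ : M → Coord n) (x : M) : Matrix (Fin n) (Fin n) ℝ :=
  Matrix.of fun i j => g.inner x (basisVec I φ x i) (basisVec I φ x j)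

/-! ### The effective operator -/

/-- `T` is the value at `x` of the effective operator `B` that is built from the atlas `𝒜`, the
cell `Y` and the material property `D`: in every chart of `𝒜` around `x` one has
`T (∂/∂xⁱ) = ∑ₖ B_i^k ∂/∂xᵏ`, with `B_i^k` computed from solutions `wᵢ` of the cell problems for
the metric `∑ g_{ij}(x) dyⁱ ⊗ dyʲ` on `Y`. -/
def IsEffectiveOperator {ι : Type*} (𝒜 : Atlas I M ι) (Y : Cell n) (D : Coord n → ℝ) (x : M)
    (T : TangentSpace I x →ₗ[ℝ] TangentSpace I x) : Prop :=
  ∀ α, x ∈ (𝒜.chart α).source →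
    ∃ (w : Fin n → Coord n → ℝ) (p : Fin n → Coord n → Coord n),
      (∀ i, Y.IsCellSolution D (gram g (𝒜.chart α) x) i (w i) (p i)) ∧
      ∀ i, T (basisVec I (𝒜.chart α) x i) =
        ∑ k, Y.effectiveCoeff D (gram g (𝒜.chart α) x) p k i • basisVec I (𝒜.chart α) x k

/-! ### The limit problem -/

variable [MeasurableSpace M]

/-- The Riemannian volume measure. In the chart `φ` around `x₀` it is `√(det g_{ij}) dx¹…dxⁿ`;
these local measures agree on overlaps, and their supremum is the global measure. -/
def riemannianVolume : Measure M :=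
  ⨆ x₀ : M, Measure.map (extChartAt I x₀).symm
    ((volume.restrict (extChartAt I x₀).target).withDensity fun y =>
      ENNReal.ofReal √(gram g (extChartAt I x₀) ((extChartAt I x₀).symm y)).det)

/-- The gradient `∇_M φ` at `x`, defined by `g (∇_M φ, v) = dφ(v)`. -/
def gradM (φ : M → ℝ) (x : M) : TangentSpace I x :=
  (g.inner x).inverse (mfderiv I 𝓘(ℝ, ℝ) φ x)

/-- A vector field whose components in the coordinate charts are a.e. strongly measurable. -/
def AEMeasurableField (X : ∀ x : M, TangentSpace I x) : Prop :=
  ∀ x₀ : M, AEStronglyMeasurable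
    (fun x => (mfderiv I 𝓘(ℝ, Coord n) (extChartAt I x₀) x (X x) : Coord n))
    ((riemannianVolume g).restrict (extChartAt I x₀).source)

/-- `u` belongs to `H¹₀(M)`, the `H¹`-closure of the smooth functions with compact support in the
interior of `M`, and the vector field `X` is its weak gradient `∇_M u`. -/
def MemH10 (u : M → ℝ) (X : ∀ x : M, TangentSpace I x) : Prop :=
  MemLp u 2 (riemannianVolume g) ∧ AEMeasurableField g X ∧
  ∃ φ : ℕ → M → ℝ,
    (∀ k, ContMDiff I 𝓘(ℝ, ℝ) ∞ (φ k) ∧ HasCompactSupport (φ k) ∧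
      tsupport (φ k) ⊆ I.interior M) ∧
    Tendsto (fun k => eLpNorm (fun x => φ k x - u x) 2 (riemannianVolume g)) atTop (𝓝 0) ∧
    Tendsto (fun k => ∫⁻ x, ENNReal.ofReal
      (g.inner x (gradM g (φ k) x - X x) (gradM g (φ k) x - X x)) ∂(riemannianVolume g))
      atTop (𝓝 0)

/-- `u` is a weak solution in `H¹₀(M)` of the limit problem `-div_M (B ∇_M u) + c u = f` in `M`,
`u = 0` on `∂M`, where `B` is the effective operator built from `𝒜`, `Y` and `D`. -/
def IsLimitSolution {ι : Type*} (𝒜 : Atlas I M ι) (Y : Cell n) (D : Coord n → ℝ)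
    (c : ℝ) (f u : M → ℝ) : Prop :=
  ∃ B : ∀ x : M, TangentSpace I x →ₗ[ℝ] TangentSpace I x,
    (∀ x, IsEffectiveOperator g 𝒜 Y D x (B x)) ∧
    ∃ X : ∀ x : M, TangentSpace I x, MemH10 g u X ∧
      ∀ (φ : M → ℝ) (Φ : ∀ x : M, TangentSpace I x), MemH10 g φ Φ →
        (∫ x, g.inner x (B x (X x)) (Φ x) ∂(riemannianVolume g)) +
            ∫ x, c * u x * φ x ∂(riemannianVolume g) =
          ∫ x, f x * φ x ∂(riemannianVolume g)

end Manifold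

end Homogenization

end

open Homogenization

/-!
The effective operator at `x` depends on the cell only through the *mean flux*: for a constant
metric `G` on `Y` and a vector `v`, solve the cell problem `-div (D ∇w) = div (D v)` and put
`b = |Y|⁻¹ ∫_Y D (v + ∇w)`. Let `R` be a square root of the cotangent metric `G⁻¹`. After
weighting covector fields by `√D R`, the weak cell problem says that the sum of the weighted
constant field `v` and the weighted gradient of `w` is orthogonal in `L²(Y)` to the closed space of
weighted periodic gradients. Hence the solution is minus an orthogonal projection of `v`, and
`b = B v` for exactly one linear map `B`
(`Cell.exists_linearMap_isFlux_iff`). The Poincaré inequality (`Cell.eLpNorm_sub_average_le`) shows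
that each field in the closure is the gradient of an element of `H¹_#(Y)`, so that the projection
does give a solution. In a chart with differential `L` at `x`, an effective operator `T` is then
characterized by `T = L⁻¹ B L` (`exists_effectiveCoeff_iff`). Charts of one UC-atlas differ by
constants, so they share `L` and the coordinate metric, which gives existence, uniqueness and
independence of the chart (`isEffectiveOperator_iff`).

For the comparison of the two atlases, `F` is a linear bijection of boxes. Normalizing all side
lengths to one, it is an isometry of the sup norm and therefore a signed permutation matrix
(`exists_int_eq_of_sum_abs_le_one`). So it maps one period lattice into the other, and composition
with `F` identifies `H¹_#(Z)` with `H¹_#(Y)` (`Cell.MemH1Per.comp_equiv`). It is an isometry of the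
two coordinate metrics, being the differential of the change of charts, and it carries `D_Y` to
`D_Z`. Consequently it intertwines the flux maps, `B_Z F = F B_Y` (`Cell.IsFlux.map`). The second
charts have differential `F L`, and `(F L)⁻¹ B_Z (F L) = L⁻¹ B_Y L`: the effective operators agree
at each point, and with them the limit problems.
-/

/-! ### Cells and linear maps between cells -/

namespace Homogenization

/-- If `A` and `B` are mutually inverse matrices whose rows have `ℓ¹`-norm at most `1` (so that
they are isometries of the sup norm), then the entries of `A` are integers: `A` is a signed
permutation matrix. -/
theorem exists_int_eq_of_sum_abs_le_one {ι : Type*} [Fintype ι] [DecidableEq ι]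
    {A B : Matrix ι ι ℝ} (hAB : A * B = 1) (hBA : B * A = 1)
    (hA : ∀ i, ∑ j, |A i j| ≤ 1) (hB : ∀ i, ∑ j, |B i j| ≤ 1) (i j : ι) :
    ∃ k : ℤ, A i j = k := by
  by_cases h0 : A i j = 0
  · exact ⟨0, by simp [h0]⟩
  have hB1 : ∀ a b, |B a b| ≤ 1 := fun a b =>
    (Finset.single_le_sum (f := fun b => |B a b|) (fun _ _ => abs_nonneg _)
      (Finset.mem_univ b)).trans (hB a)
  -- `∑ⱼ A_{ij} B_{ji} = 1` forces equality in `∑ⱼ |A_{ij}| |B_{ji}| ≤ ∑ⱼ |A_{ij}| ≤ 1`.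
  have hsum : ∑ j, |A i j| * (1 - |B j i|) ≤ 0 := by
    have h1 : (1 : ℝ) ≤ ∑ j, |A i j| * |B j i| := by
      have := congrFun (congrFun hAB i) i
      rw [Matrix.mul_apply, Matrix.one_apply_eq] at this
      rw [← this]
      exact Finset.sum_le_sum fun j _ => (le_abs_self _).trans (abs_mul _ _).le
    simp only [mul_sub, mul_one, Finset.sum_sub_distrib]
    linarith [hA i]
  have hterm : |A i j| * (1 - |B j i|) ≤ 0 :=
    (Finset.single_le_sum (f := fun j => |A i j| * (1 - |B j i|))
      (fun a _ => mul_nonneg (abs_nonneg _) (sub_nonneg.2 (hB1 a i)))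
      (Finset.mem_univ j)).trans hsum
  have hpos : 0 < |A i j| := abs_pos.2 h0
  have hBji : |B j i| = 1 := le_antisymm (hB1 j i) (by nlinarith)
  have hBz : ∀ k, k ≠ i → B j k = 0 := by
    intro k hk
    have h2 : |B j i| + |B j k| ≤ 1 := by
      refine le_trans ?_ (hB j)
      rw [← Finset.sum_pair (f := fun k => |B j k|) hk.symm]
      exact Finset.sum_le_sum_of_subset_of_nonneg (Finset.subset_univ _)
        fun _ _ _ => abs_nonneg _
    exact abs_eq_zero.1 (le_antisymm (by linarith) (abs_nonneg _))
  have hprod : B j i * A i j = 1 := by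
    have := congrFun (congrFun hBA j) j
    rw [Matrix.mul_apply, Matrix.one_apply_eq,
      Finset.sum_eq_single i (fun k _ hk => by rw [hBz k hk, zero_mul]) (by simp)] at this
    exact this
  rcases eq_or_eq_neg_of_abs_eq hBji with h | h
  · exact ⟨1, by rw [h] at hprod; push_cast; linarith⟩
  · exact ⟨-1, by rw [h] at hprod; push_cast; linarith⟩

theorem linearMap_apply_eq_sum {n : ℕ} (F : Coord n →ₗ[ℝ] Coord n) (y : Coord n) (i : Fin n) :
    F y i = ∑ j, F (EuclideanSpace.single j 1) i * y j := by
  conv_lhs => rw [← (EuclideanSpace.basisFun (Fin n) ℝ).sum_repr y]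
  simp [map_sum, mul_comm]

namespace Cell

variable {n : ℕ}

theorem carrier_eq_preimage (Y : Cell n) :
    Y.carrier = EuclideanSpace.equiv (Fin n) ℝ ⁻¹' Set.Icc Y.lo Y.up := by
  ext y
  simp only [carrier, Set.mem_ofPred_eq, Set.mem_preimage, Set.mem_Icc, Pi.le_def]
  exact ⟨fun h => ⟨fun i => (h i).1, fun i => (h i).2⟩, fun h i => ⟨h.1 i, h.2 i⟩⟩

theorem isCompact_carrier (Y : Cell n) : IsCompact Y.carrier := by
  rw [carrier_eq_preimage]
  exact (EuclideanSpace.equiv (Fin n) ℝ).toHomeomorph.isCompact_preimage.2 isCompact_Icc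

theorem measurableSet_carrier (Y : Cell n) : MeasurableSet Y.carrier :=
  Y.isCompact_carrier.isClosed.measurableSet

theorem convex_carrier (Y : Cell n) : Convex ℝ Y.carrier := by
  rw [carrier_eq_preimage]
  exact (convex_Icc _ _).linear_preimage (EuclideanSpace.equiv (Fin n) ℝ).toLinearMap

theorem interior_carrier_nonempty (Y : Cell n) : (interior Y.carrier).Nonempty := by
  refine ⟨WithLp.toLp 2 fun i => (Y.lo i + Y.up i) / 2, mem_interior.2
    ⟨{y | ∀ i, y i ∈ Set.Ioo (Y.lo i) (Y.up i)}, fun y hy i => Ioo_subset_Icc_self (hy i), ?_,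
      fun i => ?_⟩⟩
  · simp only [Set.ofPred_forall]
    exact isOpen_iInter_of_finite fun i => isOpen_Ioo.preimage (by fun_prop)
  · have := Y.lo_lt_up i
    simp only [Set.mem_Ioo]
    constructor <;> linarith

theorem volume_carrier_ne_zero (Y : Cell n) : volume Y.carrier ≠ 0 :=
  (Measure.measure_pos_of_nonempty_interior volume Y.interior_carrier_nonempty).ne'

theorem volume_carrier_ne_top (Y : Cell n) : volume Y.carrier ≠ ⊤ :=
  Y.isCompact_carrier.measure_lt_top.ne

instance (Y : Cell n) : IsFiniteMeasure Y.measure :=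
  isFiniteMeasure_restrict.2 Y.volume_carrier_ne_top

/-- A linear map that sends one cell into another sends the symmetrized first cell
`∏ⱼ [-ℓⱼ, ℓⱼ]` into the symmetrized second one, where `ℓⱼ` are the side lengths. -/
theorem sum_abs_mul_le {Y Z : Cell n} {F : Coord n →ₗ[ℝ] Coord n}
    (hF : Set.MapsTo F Y.carrier Z.carrier) (i : Fin n) :
    ∑ j, |F (EuclideanSpace.single j 1) i| * (Y.up j - Y.lo j) ≤ Z.up i - Z.lo i := by
  have ha := (hF (x := WithLp.toLp 2 fun j =>
    if 0 ≤ F (EuclideanSpace.single j 1) i then Y.up j else Y.lo j)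
    (fun j => by have := (Y.lo_lt_up j).le; dsimp only; split_ifs <;> simp [this])) i
  have hb := (hF (x := WithLp.toLp 2 fun j =>
    if 0 ≤ F (EuclideanSpace.single j 1) i then Y.lo j else Y.up j)
    (fun j => by have := (Y.lo_lt_up j).le; dsimp only; split_ifs <;> simp [this])) i
  rw [linearMap_apply_eq_sum] at ha hb
  refine le_trans (le_of_eq ?_) (sub_le_sub ha.2 hb.1)
  rw [← Finset.sum_sub_distrib]
  refine Finset.sum_congr rfl fun j _ => ?_
  dsimp only
  split_ifs with h
  · rw [abs_of_nonneg h]; ring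
  · rw [abs_of_neg (not_le.1 h)]; ring

theorem surjective_of_surjOn {Y Z : Cell n} {F : Coord n →ₗ[ℝ] Coord n}
    (hF : Set.SurjOn F Y.carrier Z.carrier) : Function.Surjective F := by
  rw [← LinearMap.range_eq_top]
  refine Submodule.eq_top_of_nonempty_interior' _
    (Z.interior_carrier_nonempty.mono (interior_mono ?_))
  intro z hz
  obtain ⟨y, -, rfl⟩ := hF hz
  exact ⟨y, rfl⟩

/-- A linear bijection between two cells sends each edge vector of the first to a vector of the
period lattice of the second. -/
theorem exists_int_map_edge {Y Z : Cell n} (e : Coord n ≃L[ℝ] Coord n)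
    (he : Set.BijOn e Y.carrier Z.carrier) (j : Fin n) :
    ∃ k : Fin n → ℤ, e (Y.edge j) = ∑ i, k i • Z.edge i := by
  have he' : Set.MapsTo e.symm Z.carrier Y.carrier := by
    intro z hz
    obtain ⟨y, hy, rfl⟩ := he.surjOn hz
    simpa using hy
  have hY : ∀ i, 0 < Y.up i - Y.lo i := fun i => sub_pos.2 (Y.lo_lt_up i)
  have hZ : ∀ i, 0 < Z.up i - Z.lo i := fun i => sub_pos.2 (Z.lo_lt_up i)
  -- The matrices of `e` and `e⁻¹`, with all side lengths normalized to one.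
  have key : ∀ (Y Z : Cell n) (e : Coord n ≃L[ℝ] Coord n),
      (Matrix.of fun i j => e (EuclideanSpace.single j 1) i * (Y.up j - Y.lo j) /
        (Z.up i - Z.lo i)) *
      (Matrix.of fun i j => e.symm (EuclideanSpace.single j 1) i * (Z.up j - Z.lo j) /
        (Y.up i - Y.lo i)) = (1 : Matrix (Fin n) (Fin n) ℝ) := by
    intro Y Z e
    have hY : ∀ i, Y.up i - Y.lo i ≠ 0 := fun i => (sub_pos.2 (Y.lo_lt_up i)).ne'
    have hZ : ∀ i, Z.up i - Z.lo i ≠ 0 := fun i => (sub_pos.2 (Z.lo_lt_up i)).ne'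
    ext i j
    have h := linearMap_apply_eq_sum (e : Coord n →ₗ[ℝ] Coord n)
      (e.symm (EuclideanSpace.single j 1)) i
    simp only [LinearEquiv.coe_coe, ContinuousLinearEquiv.coe_toLinearEquiv,
      ContinuousLinearEquiv.apply_symm_apply] at h
    rw [Matrix.mul_apply]
    simp only [Matrix.of_apply]
    have h2 : ∀ k, e (EuclideanSpace.single k 1) i * (Y.up k - Y.lo k) / (Z.up i - Z.lo i) *
        (e.symm (EuclideanSpace.single j 1) k * (Z.up j - Z.lo j) / (Y.up k - Y.lo k)) =
        (e (EuclideanSpace.single k 1) i * e.symm (EuclideanSpace.single j 1) k) *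
          ((Z.up j - Z.lo j) / (Z.up i - Z.lo i)) := by
      intro k
      field_simp [hY k, hZ i]
    simp only [h2]
    rw [← Finset.sum_mul, ← h]
    rcases eq_or_ne i j with rfl | hij
    · simp [hZ i]
    · simp [hij]
  have row : ∀ (Y Z : Cell n) (e : Coord n ≃L[ℝ] Coord n),
      Set.MapsTo e Y.carrier Z.carrier → ∀ i, ∑ j, |(Matrix.of fun i j : Fin n =>
        e (EuclideanSpace.single j 1) i * (Y.up j - Y.lo j) / (Z.up i - Z.lo i)) i j| ≤ 1 := by
    intro Y Z e he i
    have h := sum_abs_mul_le (F := (e : Coord n →ₗ[ℝ] Coord n)) he i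
    have hZ : 0 < Z.up i - Z.lo i := sub_pos.2 (Z.lo_lt_up i)
    rw [← div_le_one hZ, Finset.sum_div] at h
    refine le_trans (le_of_eq (Finset.sum_congr rfl fun j _ => ?_)) h
    rw [Matrix.of_apply, abs_div, abs_mul, abs_of_pos hZ,
      abs_of_pos (sub_pos.2 (Y.lo_lt_up j))]
    rfl
  choose k hk using fun i => exists_int_eq_of_sum_abs_le_one (key Y Z e)
    (by simpa using key Z Y e.symm) (row Y Z e he.mapsTo) (row Z Y e.symm he') i j
  refine ⟨k, ?_⟩
  ext i
  have h1 := hk i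
  rw [Matrix.of_apply, div_eq_iff (hZ i).ne'] at h1
  have h2 : Y.edge j = (Y.up j - Y.lo j) • EuclideanSpace.single j (1 : ℝ) := by
    ext i
    by_cases h : i = j <;> simp [edge, h]
  rw [h2, map_smul]
  simp only [PiLp.smul_apply, smul_eq_mul, WithLp.ofLp_sum, Finset.sum_apply, edge]
  rw [mul_comm, h1, Finset.sum_eq_single i]
  · simp
  · intro b _ hb
    simp [hb.symm]
  · simp

/-- Functions that are periodic for a cell pull back, under a linear bijection of cells, to
periodic functions. -/
theorem IsPeriodic.comp_equiv {Y Z : Cell n} {e : Coord n ≃L[ℝ] Coord n}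
    (he : Set.BijOn e Y.carrier Z.carrier) {h : Coord n → ℝ} (hh : Z.IsPeriodic h) :
    Y.IsPeriodic (h ∘ e) := by
  intro y j
  obtain ⟨k, hk⟩ := exists_int_map_edge e he j
  have hper : ∀ s : Finset (Fin n), Function.Periodic h (∑ i ∈ s, k i • Z.edge i) := by
    intro s
    induction s using Finset.induction_on with
    | empty => intro z; simp
    | insert a s ha ih =>
      rw [Finset.sum_insert ha]
      exact Function.Periodic.add_period (Function.Periodic.zsmul (fun z => hh z a) (k a)) ih
  simp only [Function.comp_apply, map_add, hk]
  exact hper _ _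

end Cell

end Homogenization

/-! ### The Poincaré inequality on a cell -/

namespace Homogenization

/-- The Cauchy–Schwarz inequality against the constant function `1`. -/
theorem sq_lintegral_le {α : Type*} [MeasurableSpace α] (μ : Measure α) {h : α → ℝ≥0∞}
    (hh : AEMeasurable h μ) :
    (∫⁻ a, h a ∂μ) ^ 2 ≤ μ Set.univ * ∫⁻ a, h a ^ 2 ∂μ := by
  have H := ENNReal.lintegral_mul_le_Lp_mul_Lq μ Real.HolderConjugate.two_two
    (aemeasurable_const (b := (1 : ℝ≥0∞))) hh
  simp only [Pi.mul_apply, one_mul, ENNReal.rpow_ofNat, one_pow, lintegral_one] at H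
  calc (∫⁻ a, h a ∂μ) ^ 2
      ≤ (μ Set.univ ^ (1 / 2 : ℝ) * (∫⁻ a, h a ^ 2 ∂μ) ^ (1 / 2 : ℝ)) ^ 2 := by gcongr
    _ = μ Set.univ * ∫⁻ a, h a ^ 2 ∂μ := by
        rw [mul_pow, ← ENNReal.rpow_natCast, ← ENNReal.rpow_natCast, ← ENNReal.rpow_mul,
          ← ENNReal.rpow_mul]
        norm_num

theorem eLpNorm_two_sq {α E : Type*} [MeasurableSpace α] [NormedAddCommGroup E] (μ : Measure α)
    (f : α → E) : eLpNorm f 2 μ ^ 2 = ∫⁻ a, ‖f a‖ₑ ^ 2 ∂μ := by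
  rw [eLpNorm_eq_lintegral_rpow_enorm_toReal (by simp) (by simp), ← ENNReal.rpow_natCast,
    ← ENNReal.rpow_mul]
  norm_num

/-- The change of variables `y ↦ a + t y` with `t ≥ 1/2` enlarges integrals at most by the
factor `2ⁿ`. -/
theorem lintegral_comp_add_smul_le {n : ℕ} {f : Coord n → ℝ≥0∞} (hf : Measurable f)
    (a : Coord n) {t : ℝ} (ht : 1 / 2 ≤ t) :
    ∫⁻ y, f (a + t • y) ≤ 2 ^ n * ∫⁻ y, f y := by
  have ht0 : 0 < t := by linarith
  have h1 : ∫⁻ y, f (a + t • y) = ∫⁻ y, f (a + y) ∂(Measure.map (fun y => t • y) volume) := by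
    rw [lintegral_map (by fun_prop) (by fun_prop)]
  rw [h1, Measure.map_addHaar_smul _ ht0.ne', lintegral_smul_measure,
    lintegral_add_left_eq_self f a, smul_eq_mul, finrank_euclideanSpace_fin]
  gcongr
  rw [abs_of_pos (by positivity), ← inv_pow, ENNReal.ofReal_pow (by positivity)]
  gcongr
  rw [show (2 : ℝ≥0∞) = ENNReal.ofReal 2 by simp]
  refine ENNReal.ofReal_le_ofReal ?_
  rw [inv_le_comm₀ ht0 (by norm_num)]
  linarith

/-- One of the weights `1 - t`, `t` of the convex combination is at least `1/2`; integrating first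
over the variable with that weight bounds the double integral uniformly in `t`. -/
theorem lintegral_lintegral_comp_lineMap_le {n : ℕ} {f : Coord n → ℝ≥0∞} (hf : Measurable f)
    (μ : Measure (Coord n)) [IsFiniteMeasure μ] (hμ : μ ≤ volume) (t : ℝ) :
    ∫⁻ y, ∫⁻ z, f ((1 - t) • z + t • y) ∂μ ∂μ ≤ 2 ^ n * (∫⁻ y, f y) * μ Set.univ := by
  rcases le_total (1 / 2) t with ht | ht
  · rw [lintegral_lintegral_swap (by fun_prop)]
    rw [← lintegral_const]
    exact lintegral_mono fun z =>
      (lintegral_mono' hμ le_rfl).trans (lintegral_comp_add_smul_le hf _ ht)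
  · rw [← lintegral_const]
    refine lintegral_mono fun z => (lintegral_mono' hμ le_rfl).trans ?_
    simp_rw [add_comm _ (t • z)]
    exact lintegral_comp_add_smul_le hf _ (by linarith)

/-- The fundamental theorem of calculus along a segment, with the Cauchy–Schwarz inequality. -/
theorem enorm_sub_sq_le_lintegral {n : ℕ} {φ : Coord n → ℝ} (hφ : ContDiff ℝ 1 φ)
    (y z : Coord n) :
    ‖φ y - φ z‖ₑ ^ 2 ≤
      ‖y - z‖ₑ ^ 2 * ∫⁻ t in Set.Ioc (0 : ℝ) 1, ‖gradient φ ((1 - t) • z + t • y)‖ₑ ^ 2 := by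
  have hd : ∀ t : ℝ, HasDerivAt (fun t : ℝ => φ ((1 - t) • z + t • y))
      (fderiv ℝ φ ((1 - t) • z + t • y) (y - z)) t := by
    intro t
    have h1 : HasDerivAt (fun t : ℝ => (1 - t) • z + t • y) (y - z) t := by
      have h2 := (((hasDerivAt_id t).const_sub 1).smul_const z).add
        ((hasDerivAt_id t).smul_const y)
      convert! h2 using 1
      simp [sub_eq_neg_add]
    exact ((hφ.differentiable one_ne_zero _).hasFDerivAt).comp_hasDerivAt t h1
  have hc : Continuous fun t : ℝ => fderiv ℝ φ ((1 - t) • z + t • y) :=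
    (hφ.continuous_fderiv one_ne_zero).comp (by fun_prop)
  have hftc := intervalIntegral.integral_eq_sub_of_hasDerivAt (a := 0) (b := 1)
    (fun t _ => hd t) ((hc.clm_apply continuous_const).intervalIntegrable 0 1)
  simp only [sub_self, zero_smul, one_smul, zero_add, sub_zero, add_zero] at hftc
  rw [← hftc, intervalIntegral.integral_of_le zero_le_one]
  have hgrad : ∀ x, ‖gradient φ x‖ₑ = ‖fderiv ℝ φ x‖ₑ := fun x => by
    simp [gradient, enorm_eq_nnnorm]
  simp only [hgrad]
  calc ‖∫ t in Set.Ioc (0 : ℝ) 1, fderiv ℝ φ ((1 - t) • z + t • y) (y - z)‖ₑ ^ 2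
      ≤ (∫⁻ t in Set.Ioc (0 : ℝ) 1, ‖fderiv ℝ φ ((1 - t) • z + t • y) (y - z)‖ₑ) ^ 2 := by
        gcongr
        exact enorm_integral_le_lintegral_enorm _
    _ ≤ (∫⁻ t in Set.Ioc (0 : ℝ) 1, ‖fderiv ℝ φ ((1 - t) • z + t • y)‖ₑ * ‖y - z‖ₑ) ^ 2 := by
        gcongr
        exact ContinuousLinearMap.le_opENorm _ _
    _ = ‖y - z‖ₑ ^ 2 *
          (∫⁻ t in Set.Ioc (0 : ℝ) 1, ‖fderiv ℝ φ ((1 - t) • z + t • y)‖ₑ) ^ 2 := by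
        rw [lintegral_mul_const' _ _ enorm_ne_top, mul_pow, mul_comm]
    _ ≤ _ := by
        gcongr
        refine (sq_lintegral_le _ hc.enorm.aemeasurable).trans (le_of_eq ?_)
        simp

namespace Cell

variable {n : ℕ}

theorem continuous_gradient {φ : Coord n → ℝ} (hφ : ContDiff ℝ 1 φ) :
    Continuous (gradient φ) :=
  (InnerProductSpace.toDual ℝ (Coord n)).symm.continuous.comp
    (hφ.continuous_fderiv one_ne_zero)

/-- The Poincaré inequality. The squared deviation from the mean is at most the mean of
`|φ y - φ z|²`, which the fundamental theorem of calculus bounds by an integral of `|∇φ|²` over the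
segment from `z` to `y`; the segment stays in the cell by convexity. -/
theorem eLpNorm_sub_average_le (Y : Cell n) : ∃ C : ℝ≥0∞, C ≠ ⊤ ∧ ∀ φ : Coord n → ℝ,
    ContDiff ℝ 1 φ →
      eLpNorm (fun y => φ y - ⨍ z, φ z ∂Y.measure) 2 Y.measure ≤
        C * eLpNorm (gradient φ) 2 Y.measure := by
  set V : ℝ≥0∞ := Y.measure Set.univ with hV
  have hVY : V = volume Y.carrier := by simp [hV, measure]
  have hV0 : V ≠ 0 := hVY ▸ Y.volume_carrier_ne_zero
  have hVt : V ≠ ⊤ := hVY ▸ Y.volume_carrier_ne_top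
  set d : ℝ≥0∞ := Metric.ediam Y.carrier with hd
  have hdt : d ≠ ⊤ := Y.isCompact_carrier.isBounded.ediam_ne_top
  refine ⟨d * 2 ^ n, ENNReal.mul_ne_top hdt (by simp), fun φ hφ => ?_⟩
  have hYm := Y.measurableSet_carrier
  have hg : Measurable fun y => ‖gradient φ y‖ₑ ^ 2 :=
    ((continuous_gradient hφ).enorm.measurable).pow_const 2
  -- The squared gradient, cut off outside the cell.
  set f : Coord n → ℝ≥0∞ := Y.carrier.indicator fun y => ‖gradient φ y‖ₑ ^ 2 with hf
  have hfm : Measurable f := hg.indicator hYm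
  have hfint : ∫⁻ y, f y = ∫⁻ y, ‖gradient φ y‖ₑ ^ 2 ∂Y.measure := lintegral_indicator hYm _
  have hint : IntegrableOn φ Y.carrier volume :=
    hφ.continuous.continuousOn.integrableOn_compact Y.isCompact_carrier
  change Integrable φ Y.measure at hint
  have hae : ∀ᵐ y ∂Y.measure, y ∈ Y.carrier := ae_restrict_mem hYm
  have hpt : ∀ y ∈ Y.carrier, ∀ z ∈ Y.carrier, ‖φ y - φ z‖ₑ ^ 2 ≤
      d ^ 2 * ∫⁻ t in Set.Ioc (0 : ℝ) 1, f ((1 - t) • z + t • y) := by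
    intro y hy z hz
    refine (enorm_sub_sq_le_lintegral hφ y z).trans ?_
    refine mul_le_mul' (pow_le_pow_left' ?_ 2) ?_
    · rw [← edist_eq_enorm_sub]
      exact Metric.edist_le_ediam_of_mem hy hz
    · refine setLIntegral_mono' measurableSet_Ioc fun t ht => ?_
      rw [hf, Set.indicator_of_mem]
      exact Y.convex_carrier hz hy (by linarith [ht.2]) ht.1.le (by ring)
  have hav : ∀ y, ‖φ y - ⨍ z, φ z ∂Y.measure‖ₑ ^ 2 ≤
      V⁻¹ * ∫⁻ z, ‖φ y - φ z‖ₑ ^ 2 ∂Y.measure := by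
    intro y
    have h1 : φ y - ⨍ z, φ z ∂Y.measure = V.toReal⁻¹ * ∫ z, (φ y - φ z) ∂Y.measure := by
      rw [integral_sub (integrable_const _) hint, average_eq, integral_const]
      have : V.toReal ≠ 0 := ENNReal.toReal_ne_zero.2 ⟨hV0, hVt⟩
      simp only [Measure.real, ← hV, smul_eq_mul]
      field_simp
    rw [h1, enorm_mul, mul_pow]
    have h2 : ‖V.toReal⁻¹‖ₑ = V⁻¹ := by
      rw [Real.enorm_eq_ofReal (by positivity), ENNReal.ofReal_inv_of_pos
        (ENNReal.toReal_pos hV0 hVt), ENNReal.ofReal_toReal hVt]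
    rw [h2]
    calc V⁻¹ ^ 2 * ‖∫ z, (φ y - φ z) ∂Y.measure‖ₑ ^ 2
        ≤ V⁻¹ ^ 2 * (V * ∫⁻ z, ‖φ y - φ z‖ₑ ^ 2 ∂Y.measure) := by
          gcongr
          refine (pow_le_pow_left' (enorm_integral_le_lintegral_enorm _) 2).trans
            (sq_lintegral_le _ ?_)
          have := hφ.continuous
          exact Continuous.aemeasurable (by fun_prop)
      _ = V⁻¹ * ∫⁻ z, ‖φ y - φ z‖ₑ ^ 2 ∂Y.measure := by
          rw [sq, mul_assoc, ← mul_assoc V⁻¹ V, ENNReal.inv_mul_cancel hV0 hVt, one_mul]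
  have hmu : Y.measure ≤ volume := Measure.restrict_le_self
  have hmain : eLpNorm (fun y => φ y - ⨍ z, φ z ∂Y.measure) 2 Y.measure ^ 2 ≤
      (d * 2 ^ n * eLpNorm (gradient φ) 2 Y.measure) ^ 2 := by
    rw [mul_pow, eLpNorm_two_sq, eLpNorm_two_sq, ← hfint]
    calc ∫⁻ y, ‖φ y - ⨍ z, φ z ∂Y.measure‖ₑ ^ 2 ∂Y.measure
        ≤ ∫⁻ y, V⁻¹ * ∫⁻ z, (d ^ 2 * ∫⁻ t in Set.Ioc (0 : ℝ) 1, f ((1 - t) • z + t • y))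
            ∂Y.measure ∂Y.measure := by
          refine lintegral_mono_ae (hae.mono fun y hy => (hav y).trans ?_)
          gcongr V⁻¹ * ?_
          exact lintegral_mono_ae (hae.mono fun z hz => hpt y hy z hz)
      _ = V⁻¹ * (d ^ 2 * ∫⁻ y, ∫⁻ z, (∫⁻ t in Set.Ioc (0 : ℝ) 1, f ((1 - t) • z + t • y))
            ∂Y.measure ∂Y.measure) := by
          rw [lintegral_const_mul' _ _ (ENNReal.inv_ne_top.2 hV0)]
          simp_rw [lintegral_const_mul' _ _ (ENNReal.pow_ne_top hdt)]
      _ = V⁻¹ * (d ^ 2 * ∫⁻ t in Set.Ioc (0 : ℝ) 1, (∫⁻ y, ∫⁻ z, f ((1 - t) • z + t • y)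
            ∂Y.measure ∂Y.measure)) := by
          congr 2
          refine (lintegral_congr fun y => lintegral_lintegral_swap ?_).trans
            (lintegral_lintegral_swap ?_)
          · fun_prop
          · refine Measurable.aemeasurable ?_
            refine Measurable.lintegral_prod_right' (f := fun p : (Coord n × ℝ) × Coord n =>
              f ((1 - p.1.2) • p.2 + p.1.2 • p.1.1)) ?_
            fun_prop
      _ ≤ V⁻¹ * (d ^ 2 * ∫⁻ t in Set.Ioc (0 : ℝ) 1, 2 ^ n * (∫⁻ y, f y) * V) := by
          gcongr with t
          exact lintegral_lintegral_comp_lineMap_le hfm Y.measure hmu t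
      _ = d ^ 2 * 2 ^ n * ∫⁻ y, f y := by
          simp only [lintegral_const, Measure.restrict_apply MeasurableSet.univ, Set.univ_inter,
            Real.volume_Ioc, sub_zero, ENNReal.ofReal_one, mul_one]
          rw [show V⁻¹ * (d ^ 2 * (2 ^ n * (∫⁻ y, f y) * V)) =
            (V⁻¹ * V) * (d ^ 2 * 2 ^ n * ∫⁻ y, f y) by ring, ENNReal.inv_mul_cancel hV0 hVt,
            one_mul]
      _ ≤ (d * 2 ^ n) ^ 2 * ∫⁻ y, f y := by
          rw [mul_pow]
          refine mul_le_mul_left ?_ _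
          refine mul_le_mul_right ?_ _
          exact le_self_pow₀ (one_le_pow₀ one_le_two) two_ne_zero
  exact (ENNReal.pow_le_pow_left_iff two_ne_zero).1 hmain

end Cell

end Homogenization

/-! ### Normal form of the cell problem -/

namespace Homogenization

namespace Cell

variable {n : ℕ}

theorem sum_mul_grad {G : Matrix (Fin n) (Fin n) ℝ} (hG : G.PosDef) (q : Coord n) (i : Fin n) :
    ∑ j, G i j * grad G q j = q i := by
  have h : G *ᵥ (G⁻¹ *ᵥ q) = q := by
    rw [Matrix.mulVec_mulVec, Matrix.mul_nonsing_inv _ ((Matrix.isUnit_iff_isUnit_det _).1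
      hG.isUnit), Matrix.one_mulVec]
  exact congrFun h i

theorem inner_grad {G : Matrix (Fin n) (Fin n) ℝ} (hG : G.PosDef) (v : Fin n → ℝ)
    (q : Coord n) : inner G v (grad G q) = ∑ i, v i * q i := by
  simp only [inner]
  refine Finset.sum_congr rfl fun i _ => ?_
  rw [← sum_mul_grad hG q i, Finset.mul_sum]
  exact Finset.sum_congr rfl fun j _ => by ring

/-- The cotangent metric `G⁻¹` is the pullback of the Euclidean one by a linear automorphism. -/
theorem exists_equiv_inner_eq {G : Matrix (Fin n) (Fin n) ℝ} (hG : G.PosDef) :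
    ∃ R : Coord n ≃L[ℝ] Coord n, ∀ p q : Coord n,
      Inner.inner ℝ (R p) (R q) = ∑ k, grad G p k * q k := by
  open scoped MatrixOrder in
  obtain ⟨b, hb, hGb⟩ := CStarAlgebra.isStrictlyPositive_iff_eq_star_mul_self.1
    hG.inv.isStrictlyPositive
  have hinj : Function.Injective (Matrix.toEuclideanLin b) := by
    intro p q hpq
    have := Matrix.mulVec_injective_iff_isUnit.2 hb (a₁ := p.ofLp) (a₂ := q.ofLp)
      (by simpa [Matrix.toLpLin_apply] using hpq)
    exact WithLp.ofLp_injective 2 this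
  refine ⟨(LinearEquiv.ofInjectiveEndo _ hinj).toContinuousLinearEquiv, fun p q => ?_⟩
  have h1 : ∀ p, (LinearEquiv.ofInjectiveEndo _ hinj).toContinuousLinearEquiv p =
    WithLp.toLp 2 (b *ᵥ p.ofLp) := fun p => rfl
  have h2 : ∀ k, grad G p k = (G⁻¹ *ᵥ p.ofLp) k := fun k => rfl
  rw [h1, h1, EuclideanSpace.inner_toLp_toLp]
  simp only [h2, star_trivial]
  rw [Matrix.dotProduct_mulVec, Matrix.vecMul_mulVec, ← Matrix.dotProduct_mulVec,
    ← Matrix.conjTranspose_eq_transpose_of_trivial, ← Matrix.star_eq_conjTranspose, ← hGb,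
    dotProduct_comm]
  rfl

/-- The vector field `√D · R q`. If `R` is a square root of the cotangent metric `G⁻¹`, then the
energy `∫ D G⁻¹(p, q)` is the `L²` inner product of the weighted fields of `p` and `q`. -/
noncomputable def weight (D : Coord n → ℝ) (R : Coord n ≃L[ℝ] Coord n) (q : Coord n → Coord n) :
    Coord n → Coord n :=
  fun y => √(D y) • R (q y)

variable {Y : Cell n} {D : Coord n → ℝ} {R : Coord n ≃L[ℝ] Coord n}

theorem weight_sub (p q : Coord n → Coord n) :
    weight D R (p - q) = weight D R p - weight D R q := by
  ext1 y
  simp [weight, smul_sub]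

theorem IsMaterial.pos (hD : Y.IsMaterial D) (y : Coord n) : 0 < D y := by
  obtain ⟨-, -, d₀, d₁, h0, h⟩ := hD
  exact h0.trans_le (h y).1

theorem weight_surjective (hD : Y.IsMaterial D) (u : Coord n → Coord n) :
    weight D R (fun y => (√(D y))⁻¹ • R.symm (u y)) = u := by
  ext1 y
  have := (Real.sqrt_pos.2 (hD.pos y)).ne'
  simp [weight, smul_smul, this]

theorem exists_norm_weight_le (hD : Y.IsMaterial D) (R : Coord n ≃L[ℝ] Coord n) :
    ∃ C : ℝ, ∀ q y, ‖weight D R q y‖ ≤ C * ‖q y‖ := by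
  obtain ⟨-, -, d₀, d₁, h0, h⟩ := hD
  refine ⟨√d₁ * ‖(R : Coord n →L[ℝ] Coord n)‖, fun q y => ?_⟩
  rw [weight, norm_smul, Real.norm_of_nonneg (Real.sqrt_nonneg _), mul_assoc]
  gcongr
  · exact (h y).2
  · exact (R : Coord n →L[ℝ] Coord n).le_opNorm _

theorem exists_norm_le_weight (hD : Y.IsMaterial D) (R : Coord n ≃L[ℝ] Coord n) :
    ∃ C : ℝ, ∀ q y, ‖q y‖ ≤ C * ‖weight D R q y‖ := by
  obtain ⟨-, -, d₀, d₁, h0, h⟩ := hD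
  refine ⟨‖(R.symm : Coord n →L[ℝ] Coord n)‖ * (√d₀)⁻¹, fun q y => ?_⟩
  have h1 : ‖q y‖ ≤ ‖(R.symm : Coord n →L[ℝ] Coord n)‖ * ‖R (q y)‖ := by
    simpa using (R.symm : Coord n →L[ℝ] Coord n).le_opNorm (R (q y))
  refine h1.trans ?_
  have h2 : 0 < √d₀ := Real.sqrt_pos.2 h0
  rw [mul_assoc, weight, norm_smul, Real.norm_of_nonneg (Real.sqrt_nonneg _)]
  gcongr
  rw [← mul_assoc]
  refine le_mul_of_one_le_left (norm_nonneg _) ?_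
  rw [inv_mul_eq_div, one_le_div h2]
  exact Real.sqrt_le_sqrt (h y).1

theorem memLp_weight (hD : Y.IsMaterial D) {q : Coord n → Coord n} (hq : MemLp q 2 Y.measure) :
    MemLp (weight D R q) 2 Y.measure := by
  obtain ⟨C, hC⟩ := exists_norm_weight_le hD R
  refine hq.of_le_mul ?_ (ae_of_all _ (hC q))
  exact hD.1.sqrt.aestronglyMeasurable.smul (R.continuous.comp_aestronglyMeasurable hq.1)

theorem exists_memLp_weight_eq (hD : Y.IsMaterial D) {u : Coord n → Coord n}
    (hu : MemLp u 2 Y.measure) :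
    ∃ q, MemLp q 2 Y.measure ∧ weight D R q = u := by
  refine ⟨_, ?_, weight_surjective hD u⟩
  obtain ⟨C, hC⟩ := exists_norm_le_weight hD R
  refine MemLp.of_le_mul (g := u) (c := C) hu ?_ (ae_of_all _ fun y => ?_)
  · have hc : Continuous fun y => (√(D y))⁻¹ :=
      hD.1.sqrt.inv₀ fun y => (Real.sqrt_pos.2 (hD.pos y)).ne'
    exact hc.aestronglyMeasurable.smul (R.symm.continuous.comp_aestronglyMeasurable hu.1)
  · refine (hC (fun y => (√(D y))⁻¹ • R.symm (u y)) y).trans_eq ?_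
    rw [weight_surjective hD u]

theorem memLp_of_continuous {E : Type*} [NormedAddCommGroup E] [SecondCountableTopology E]
    {f : Coord n → E} (hf : Continuous f) : MemLp f 2 Y.measure := by
  obtain ⟨C, hC⟩ := Y.isCompact_carrier.exists_bound_of_continuousOn hf.continuousOn
  have hm : AEStronglyMeasurable f Y.measure := hf.aestronglyMeasurable
  have hae : ∀ᵐ y ∂Y.measure, y ∈ Y.carrier := ae_restrict_mem Y.measurableSet_carrier
  exact MemLp.of_bound hm C (hae.mono hC)

theorem gradient_add {φ ψ : Coord n → ℝ} (hφ : ContDiff ℝ ∞ φ) (hψ : ContDiff ℝ ∞ ψ) :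
    gradient (φ + ψ) = gradient φ + gradient ψ := by
  ext1 y
  simp only [gradient, Pi.add_apply]
  rw [fderiv_add (hφ.differentiable (by simp) y) (hψ.differentiable (by simp) y), map_add]

theorem gradient_const_smul {φ : Coord n → ℝ} (hφ : ContDiff ℝ ∞ φ) (c : ℝ) :
    gradient (c • φ) = c • gradient φ := by
  ext1 y
  simp only [gradient, Pi.smul_apply]
  rw [fderiv_const_smul (hφ.differentiable (by simp) y), map_smul]

theorem gradient_sub {φ ψ : Coord n → ℝ} (hφ : ContDiff ℝ ∞ φ) (hψ : ContDiff ℝ ∞ ψ) :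
    gradient (φ - ψ) = gradient φ - gradient ψ := by
  ext1 y
  simp only [gradient, Pi.sub_apply]
  rw [fderiv_sub (hφ.differentiable (by simp) y) (hψ.differentiable (by simp) y), map_sub]

variable (Y D R) in
/-- The closure in `L²(Y)` of the weighted gradients of smooth periodic functions. -/
noncomputable def gradSpace : Submodule ℝ (Lp (Coord n) 2 Y.measure) :=
  Submodule.topologicalClosure
    { carrier := {u | ∃ φ : Coord n → ℝ, (ContDiff ℝ ∞ φ ∧ Y.IsPeriodic φ) ∧
        u =ᵐ[Y.measure] weight D R (gradient φ)}
      zero_mem' := by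
        refine ⟨fun _ => 0, ⟨contDiff_const, fun _ _ => rfl⟩, ?_⟩
        filter_upwards [Lp.coeFn_zero (Coord n) 2 Y.measure] with y hy
        rw [hy]
        simp [weight]
      add_mem' := by
        rintro u v ⟨φ, hφ, hu⟩ ⟨ψ, hψ, hv⟩
        refine ⟨φ + ψ, ⟨hφ.1.add hψ.1, fun y i => ?_⟩, ?_⟩
        · simp [hφ.2 y i, hψ.2 y i]
        · filter_upwards [Lp.coeFn_add u v, hu, hv] with y h1 h2 h3
          rw [h1, Pi.add_apply, h2, h3, gradient_add hφ.1 hψ.1]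
          simp [weight]
      smul_mem' := by
        rintro c u ⟨φ, hφ, hu⟩
        refine ⟨c • φ, ⟨hφ.1.const_smul c, fun y i => ?_⟩, ?_⟩
        · simp [hφ.2 y i]
        · filter_upwards [Lp.coeFn_smul c u, hu] with y h1 h2
          rw [h1, Pi.smul_apply, h2, gradient_const_smul hφ.1]
          simp [weight, smul_comm c] }

/-- Smooth periodic functions whose gradients converge in `L²(Y)` converge themselves in `L²(Y)`
after subtraction of their means, by the Poincaré inequality. -/
theorem exists_memH1Per_of_tendsto_gradient {φ : ℕ → Coord n → ℝ} {q : Coord n → Coord n}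
    (hφ : ∀ k, ContDiff ℝ ∞ (φ k) ∧ Y.IsPeriodic (φ k)) (hq : MemLp q 2 Y.measure)
    (hlim : Tendsto (fun k => eLpNorm (gradient (φ k) - q) 2 Y.measure) atTop (𝓝 0)) :
    ∃ w, Y.MemH1Per w q := by
  obtain ⟨C, hCt, hC⟩ := Y.eLpNorm_sub_average_le
  have hg : ∀ k, MemLp (gradient (φ k)) 2 Y.measure := fun k =>
    memLp_of_continuous (continuous_gradient ((hφ k).1.of_le (by simp)))
  set ψ : ℕ → Coord n → ℝ := fun k y => φ k y - ⨍ z, φ k z ∂Y.measure with hψ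
  have hψs : ∀ k, ContDiff ℝ ∞ (ψ k) := fun k => (hφ k).1.sub contDiff_const
  have hψL : ∀ k, MemLp (ψ k) 2 Y.measure := fun k => memLp_of_continuous (hψs k).continuous
  have hdist : ∀ k l, edist ((hψL k).toLp (ψ k)) ((hψL l).toLp (ψ l)) ≤
      C * edist ((hg k).toLp (gradient (φ k))) ((hg l).toLp (gradient (φ l))) := by
    intro k l
    rw [Lp.edist_toLp_toLp, Lp.edist_toLp_toLp, ← gradient_sub (hφ k).1 (hφ l).1]
    have hi : ∀ k, Integrable (φ k) Y.measure := fun k =>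
      (memLp_of_continuous (hφ k).1.continuous).integrable one_le_two
    refine le_trans (le_of_eq ?_) (hC (φ k - φ l) (((hφ k).1.sub (hφ l).1).of_le (by simp)))
    congr 1
    ext1 y
    simp only [hψ, Pi.sub_apply, average_eq, integral_sub (hi k) (hi l), smul_sub]
    ring
  have hgc : CauchySeq fun k => (hg k).toLp (gradient (φ k)) :=
    ((Lp.tendsto_Lp_iff_tendsto_eLpNorm'' _ hg q hq).2 hlim).cauchySeq
  have hψc : CauchySeq fun k => (hψL k).toLp (ψ k) := by
    rw [EMetric.cauchySeq_iff] at hgc ⊢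
    intro ε hε
    obtain ⟨N, hN⟩ := hgc (ε / (C + 1)) (ENNReal.div_pos hε.ne' (by simp [hCt]))
    refine ⟨N, fun k hk l hl => (hdist k l).trans_lt ?_⟩
    have h1 := (ENNReal.lt_div_iff_mul_lt (by simp) (by simp [hCt])).1 (hN k hk l hl)
    refine lt_of_le_of_lt ?_ h1
    rw [mul_comm]
    gcongr
    exact le_self_add
  obtain ⟨w, hw⟩ := cauchySeq_tendsto_of_complete hψc
  have hwL := Lp.memLp w
  refine ⟨w, hwL, hq, ψ, fun k => ⟨hψs k, fun y i => ?_⟩, ?_, ?_⟩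
  · simp only [hψ, (hφ k).2 y i]
  · rw [← Lp.toLp_coeFn w hwL] at hw
    exact (Lp.tendsto_Lp_iff_tendsto_eLpNorm'' _ hψL _ hwL).1 hw
  · convert! hlim using 4 with k
    ext1 y
    simp only [hψ, Pi.sub_apply, gradient]
    rw [fderiv_sub_const]

/-- The space `gradSpace` consists of the weighted weak gradients of the functions in `H¹_#(Y)`.
The weight is bounded and boundedly invertible, so it does not change convergence in `L²(Y)`. -/
theorem toLp_weight_mem_gradSpace_iff (hD : Y.IsMaterial D) {q : Coord n → Coord n}
    (hq : MemLp q 2 Y.measure) :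
    (memLp_weight (R := R) hD hq).toLp _ ∈ gradSpace Y D R ↔ ∃ w, Y.MemH1Per w q := by
  have hg : ∀ {φ : Coord n → ℝ}, ContDiff ℝ ∞ φ → MemLp (gradient φ) 2 Y.measure := fun h =>
    memLp_of_continuous (continuous_gradient (h.of_le (by simp)))
  constructor
  · intro h
    obtain ⟨u, hu, hlim⟩ := mem_closure_iff_seq_limit.1 h
    choose φ hφ huφ using hu
    refine exists_memH1Per_of_tendsto_gradient hφ hq ?_
    obtain ⟨C, hC⟩ := exists_norm_le_weight hD R
    rw [Lp.tendsto_Lp_iff_tendsto_eLpNorm] at hlim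
    have hlim' := ENNReal.Tendsto.const_mul (a := ENNReal.ofReal C) hlim
      (Or.inr ENNReal.ofReal_ne_top)
    rw [mul_zero] at hlim'
    refine tendsto_of_tendsto_of_tendsto_of_le_of_le tendsto_const_nhds hlim'
      (fun _ => zero_le) fun k => ?_
    refine eLpNorm_le_mul_eLpNorm_of_ae_le_mul ?_ _
    filter_upwards [huφ k] with y hy
    refine (hC _ y).trans_eq ?_
    rw [weight_sub, Pi.sub_apply, Pi.sub_apply, hy]
  · rintro ⟨w, -, -, φ, hφ, -, hlim⟩
    refine mem_closure_iff_seq_limit.2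
      ⟨fun k => (memLp_weight (R := R) hD (hg (hφ k).1)).toLp _,
        fun k => ⟨φ k, hφ k, MemLp.coeFn_toLp _⟩, ?_⟩
    rw [Lp.tendsto_Lp_iff_tendsto_eLpNorm'']
    obtain ⟨C, hC⟩ := exists_norm_weight_le hD R
    have hlim' := ENNReal.Tendsto.const_mul (a := ENNReal.ofReal C) hlim
      (Or.inr ENNReal.ofReal_ne_top)
    rw [mul_zero] at hlim'
    refine tendsto_of_tendsto_of_tendsto_of_le_of_le tendsto_const_nhds hlim'
      (fun _ => zero_le) fun k => ?_
    refine eLpNorm_le_mul_eLpNorm_of_ae_le_mul (ae_of_all _ fun y => ?_) _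
    rw [← weight_sub]
    exact hC _ y

end Cell

end Homogenization

/-! ### The homogenized flux -/

namespace Homogenization

namespace Cell

variable {n : ℕ}

/-- `w ∈ H¹_#(Y)`, with partial derivatives `p`, solves the cell problem
`-div (D ∇w) = div (D v)` for the constant metric `G` and the constant vector `v`. For the `i`-th
standard basis vector `v` this is `IsCellSolution`. -/
def IsCellSolutionFor (Y : Cell n) (D : Coord n → ℝ) (G : Matrix (Fin n) (Fin n) ℝ)
    (v : Coord n) (w : Coord n → ℝ) (p : Coord n → Coord n) : Prop :=
  Y.MemH1Per w p ∧ ∀ φ q, Y.MemH1Per φ q →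
    ∫ y in Y.carrier, D y * inner G (grad G (p y)) (grad G (q y)) =
      - ∫ y in Y.carrier, D y * inner G v (grad G (q y))

/-- `b` is the mean flux `|Y|⁻¹ ∫_Y D (v + ∇w)` of a solution `w` of the cell problem for the
vector `v`. -/
def IsFlux (Y : Cell n) (D : Coord n → ℝ) (G : Matrix (Fin n) (Fin n) ℝ) (v b : Coord n) : Prop :=
  ∃ w p, Y.IsCellSolutionFor D G v w p ∧ ∀ k, b k =
    (volume.real Y.carrier)⁻¹ * ∫ y in Y.carrier, D y * (v k + grad G (p y) k)

variable {Y : Cell n} {D : Coord n → ℝ} {R : Coord n ≃L[ℝ] Coord n}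
  {G : Matrix (Fin n) (Fin n) ℝ}

theorem memLp_weight_const (hD : Y.IsMaterial D) (ξ : Coord n) :
    MemLp (weight D R fun _ => ξ) 2 Y.measure :=
  memLp_weight hD (memLp_const ξ)

variable (R) in
/-- The constant vector field `v`, as the weighted field `√D · (R⁻¹)ᵀ v` in `L²(Y)`. The weight
`(R⁻¹)ᵀ = R · G` is the one for vectors, whereas `R` is the one for covectors. -/
noncomputable def constField (hD : Y.IsMaterial D) : Coord n →ₗ[ℝ] Lp (Coord n) 2 Y.measure where
  toFun v := (memLp_weight_const (R := R) hD (R.symm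
    (ContinuousLinearMap.adjoint (R.symm : Coord n →L[ℝ] Coord n) v))).toLp _
  map_add' v v' := by
    rw [← MemLp.toLp_add]
    congr 1
    ext1 y
    simp [weight]
  map_smul' c v := by
    rw [RingHom.id_apply, ← MemLp.toLp_const_smul]
    congr 1
    ext1 y
    simp [weight, smul_comm c]

theorem inner_toLp_weight (hD : Y.IsMaterial D)
    (hR : ∀ p q : Coord n, Inner.inner ℝ (R p) (R q) = ∑ k, grad G p k * q k)
    {p q : Coord n → Coord n} (hp : MemLp p 2 Y.measure) (hq : MemLp q 2 Y.measure) :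
    Inner.inner ℝ ((memLp_weight (R := R) hD hp).toLp _) ((memLp_weight (R := R) hD hq).toLp _) =
      ∫ y, D y * ∑ k, grad G (p y) k * q y k ∂Y.measure := by
  rw [L2.inner_def]
  refine integral_congr_ae ?_
  filter_upwards [MemLp.coeFn_toLp (memLp_weight (R := R) hD hp),
    MemLp.coeFn_toLp (memLp_weight (R := R) hD hq)] with y h1 h2
  rw [h1, h2, weight, weight, real_inner_smul_left, real_inner_smul_right, hR, ← mul_assoc,
    Real.mul_self_sqrt (hD.pos y).le]

theorem inner_constField (hD : Y.IsMaterial D) (v : Coord n)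
    {q : Coord n → Coord n} (hq : MemLp q 2 Y.measure) :
    Inner.inner ℝ (constField R hD v) ((memLp_weight (R := R) hD hq).toLp _) =
      ∫ y, D y * ∑ k, v k * q y k ∂Y.measure := by
  rw [L2.inner_def]
  refine integral_congr_ae ?_
  filter_upwards [MemLp.coeFn_toLp (memLp_weight_const (R := R) hD (R.symm
    (ContinuousLinearMap.adjoint (R.symm : Coord n →L[ℝ] Coord n) v))),
    MemLp.coeFn_toLp (memLp_weight (R := R) hD hq)] with y h1 h2
  have h3 : constField R hD v y = √(D y) •
      ContinuousLinearMap.adjoint (R.symm : Coord n →L[ℝ] Coord n) v := by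
    refine h1.trans ?_
    simp [weight]
  rw [h3, h2, weight, real_inner_smul_left, real_inner_smul_right,
    ContinuousLinearMap.adjoint_inner_left, ← mul_assoc, Real.mul_self_sqrt (hD.pos y).le]
  congr 1
  simp [PiLp.inner_apply, mul_comm]

/-- The weak cell problem is an orthogonality relation in `L²(Y)`. -/
theorem isCellSolutionFor_iff (hD : Y.IsMaterial D) (hG : G.PosDef)
    (hR : ∀ p q : Coord n, Inner.inner ℝ (R p) (R q) = ∑ k, grad G p k * q k)
    {v : Coord n} {w : Coord n → ℝ} {p : Coord n → Coord n} (hwp : Y.MemH1Per w p) :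
    Y.IsCellSolutionFor D G v w p ↔
      constField R hD v + (memLp_weight (R := R) hD hwp.2.1).toLp _ ∈ (gradSpace Y D R)ᗮ := by
  have key : ∀ φ q, ∀ h : Y.MemH1Per φ q,
      (∫ y in Y.carrier, D y * inner G (grad G (p y)) (grad G (q y)) =
        - ∫ y in Y.carrier, D y * inner G v (grad G (q y))) ↔
      Inner.inner ℝ ((memLp_weight (R := R) hD h.2.1).toLp _)
        (constField R hD v + (memLp_weight (R := R) hD hwp.2.1).toLp _) = 0 := by
    intro φ q h
    rw [real_inner_comm, inner_add_left, inner_constField hD v h.2.1,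
      inner_toLp_weight hD hR hwp.2.1 h.2.1]
    simp only [inner_grad hG]
    rw [← add_eq_zero_iff_eq_neg, add_comm]
    rfl
  rw [Submodule.mem_orthogonal]
  constructor
  · rintro ⟨-, h⟩ u hu
    obtain ⟨q, hq, hqu⟩ := exists_memLp_weight_eq (R := R) hD (Lp.memLp u)
    have hu' : (memLp_weight (R := R) hD hq).toLp _ = u := by
      rw [← Lp.toLp_coeFn u (Lp.memLp u)]
      congr 1
    rw [← hu'] at hu ⊢
    obtain ⟨φ, hφ⟩ := (toLp_weight_mem_gradSpace_iff hD hq).1 hu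
    exact (key φ q hφ).1 (h φ q hφ)
  · intro h
    refine ⟨hwp, fun φ q hφ => (key φ q hφ).2 (h _ ?_)⟩
    exact (toLp_weight_mem_gradSpace_iff hD hφ.2.1).2 ⟨φ, hφ⟩

theorem integrable_mul_grad (hD : Y.IsMaterial D) {p : Coord n → Coord n}
    (hp : MemLp p 2 Y.measure) (k : Fin n) :
    Integrable (fun y => D y * grad G (p y) k) Y.measure := by
  have h : MemLp (fun y => grad G (p y) k) 2 Y.measure := by
    let L : Coord n →L[ℝ] ℝ := ∑ j, G⁻¹ k j • EuclideanSpace.proj j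
    have hL : ∀ x, L x = grad G x k := fun x => by simp [L, grad]
    simpa only [Function.comp_def, hL] using L.comp_memLp' hp
  exact (memLp_of_continuous hD.1).integrable_mul h

/-- The cell problem is solvable for each vector `v`, its flux is unique, and it depends linearly
on `v`: the weighted gradient of the solution is minus the orthogonal projection of the constant
field `v` to the space of gradients. -/
theorem exists_linearMap_isFlux_iff (hD : Y.IsMaterial D) (hG : G.PosDef) :
    ∃ B : Coord n →ₗ[ℝ] Coord n, ∀ v b, Y.IsFlux D G v b ↔ b = B v := by
  obtain ⟨R, hR⟩ := exists_equiv_inner_eq hG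
  set U := gradSpace Y D R with hU
  have : CompleteSpace U :=
    inferInstanceAs (CompleteSpace (Submodule.topologicalClosure _))
  let resid : Coord n →ₗ[ℝ] Lp (Coord n) 2 Y.measure :=
    constField R hD - U.starProjection.toLinearMap ∘ₗ constField R hD
  let e : Fin n → Lp (Coord n) 2 Y.measure := fun k =>
    (memLp_weight_const (R := R) hD (EuclideanSpace.single k 1)).toLp _
  let B : Coord n →ₗ[ℝ] Coord n := (WithLp.linearEquiv 2 ℝ (Fin n → ℝ)).symm.toLinearMap ∘ₗ
    LinearMap.pi fun k => (volume.real Y.carrier)⁻¹ •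
      ((innerSL ℝ (e k)).toLinearMap ∘ₗ resid)
  have hB : ∀ v k, B v k = (volume.real Y.carrier)⁻¹ * Inner.inner ℝ (resid v) (e k) := by
    intro v k
    rw [real_inner_comm]
    rfl
  have hflux : ∀ {v w p} (hs : Y.IsCellSolutionFor D G v w p) k,
      (volume.real Y.carrier)⁻¹ * ∫ y in Y.carrier, D y * (v k + grad G (p y) k) = B v k := by
    intro v w p hs k
    have hproj : resid v = constField R hD v + (memLp_weight (R := R) hD hs.1.2.1).toLp _ := by
      have h1 := (isCellSolutionFor_iff hD hG hR hs.1).1 hs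
      have h2 : -(memLp_weight (R := R) hD hs.1.2.1).toLp _ ∈ U :=
        neg_mem ((toLp_weight_mem_gradSpace_iff hD hs.1.2.1).2 ⟨w, hs.1⟩)
      have h3 := Submodule.eq_starProjection_of_mem_orthogonal h2
        (u := constField R hD v) (by rwa [sub_neg_eq_add])
      change constField R hD v - U.starProjection (constField R hD v) = _
      rw [h3, sub_neg_eq_add]
    have hconst := memLp_const (μ := Y.measure) (p := 2) (EuclideanSpace.single k (1 : ℝ))
    have hDi : Integrable (fun y => D y * v k) Y.measure :=
      ((memLp_of_continuous hD.1).integrable one_le_two).mul_const _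
    rw [hB, hproj, inner_add_left, inner_constField hD v hconst,
      inner_toLp_weight hD hR hs.1.2.1 hconst]
    congr 1
    simp only [mul_add]
    refine (integral_add hDi (integrable_mul_grad (G := G) hD hs.1.2.1 k)).trans ?_
    simp
  refine ⟨B, fun v b => ⟨?_, ?_⟩⟩
  · rintro ⟨w, p, hs, hb⟩
    ext k
    rw [hb k, hflux hs]
  · rintro rfl
    have hmem : -U.starProjection (constField R hD v) ∈ U :=
      neg_mem (Submodule.starProjection_apply_mem _ _)
    obtain ⟨p, hp, hpu⟩ := exists_memLp_weight_eq (R := R) hD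
      (Lp.memLp (-U.starProjection (constField R hD v)))
    have hu : (memLp_weight (R := R) hD hp).toLp _ = -U.starProjection (constField R hD v) := by
      rw [← Lp.toLp_coeFn (-U.starProjection (constField R hD v)) (Lp.memLp _)]
      congr 1
    obtain ⟨w, hw⟩ := (toLp_weight_mem_gradSpace_iff hD hp).1 (hu ▸ hmem)
    have hs : Y.IsCellSolutionFor D G v w p := by
      rw [isCellSolutionFor_iff hD hG hR hw, hu, ← sub_eq_add_neg]
      exact Submodule.sub_starProjection_mem_orthogonal _
    exact ⟨w, p, hs, fun k => (hflux hs k).symm⟩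

end Cell

end Homogenization

/-! ### Linear changes of cell -/

namespace Homogenization

namespace Cell

variable {n : ℕ} {Y Z : Cell n} {e : Coord n ≃L[ℝ] Coord n}

theorem bijOn_symm (he : Set.BijOn e Y.carrier Z.carrier) :
    Set.BijOn e.symm Z.carrier Y.carrier :=
  he.symm ⟨fun z _ => e.apply_symm_apply z, fun y _ => e.symm_apply_apply y⟩

theorem map_measure (he : Set.BijOn e Y.carrier Z.carrier) :
    ∃ c : ℝ≥0∞, c ≠ 0 ∧ c ≠ ⊤ ∧ Measure.map e Y.measure = c • Z.measure := by
  have hdet : LinearMap.det (e : Coord n →ₗ[ℝ] Coord n) ≠ 0 :=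
    (LinearEquiv.isUnit_det' e.toLinearEquiv).ne_zero
  refine ⟨ENNReal.ofReal |(LinearMap.det (e : Coord n →ₗ[ℝ] Coord n))⁻¹|, ?_,
    ENNReal.ofReal_ne_top, ?_⟩
  · simpa using hdet
  · have hpre : e ⁻¹' Z.carrier = Y.carrier := by
      rw [← he.image_eq, Set.preimage_image_eq _ e.injective]
    rw [measure, measure, ← hpre, ← Measure.restrict_map e.continuous.measurable
      Z.measurableSet_carrier, ← Measure.restrict_smul]
    congr 1
    exact Measure.map_linearMap_addHaar_eq_smul_addHaar volume hdet

theorem eLpNorm_comp_equiv {E : Type*} [NormedAddCommGroup E] {c : ℝ≥0∞}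
    (hc : Measure.map e Y.measure = c • Z.measure) (f : Coord n → E) :
    eLpNorm (fun y => f (e y)) 2 Y.measure = c ^ (1 / 2 : ℝ) * eLpNorm f 2 Z.measure := by
  have h := e.toHomeomorph.measurableEmbedding.eLpNorm_map_measure (g := f) (p := 2)
    (μ := Y.measure)
  have h2 : ⇑e.toHomeomorph = e := rfl
  rw [h2, hc, eLpNorm_smul_measure_of_ne_top (by simp)] at h
  simpa [Function.comp_def] using h.symm

theorem memLp_comp_equiv {E : Type*} [NormedAddCommGroup E] {c : ℝ≥0∞} (hct : c ≠ ⊤)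
    (hc : Measure.map e Y.measure = c • Z.measure) {f : Coord n → E} (hf : MemLp f 2 Z.measure) :
    MemLp (fun y => f (e y)) 2 Y.measure := by
  have h : MemLp f 2 (Measure.map e Y.measure) := hc ▸ hf.smul_measure hct
  exact h.comp_of_map e.continuous.aemeasurable

theorem gradient_comp_equiv {φ : Coord n → ℝ} (hφ : ContDiff ℝ ∞ φ) (y : Coord n) :
    gradient (φ ∘ e) y =
      ContinuousLinearMap.adjoint (e : Coord n →L[ℝ] Coord n) (gradient φ (e y)) := by
  refine ext_inner_right ℝ fun v => ?_
  rw [ContinuousLinearMap.adjoint_inner_left, inner_gradient_left, inner_gradient_left,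
    fderiv_comp y (hφ.differentiable (by simp) _) e.differentiableAt, e.fderiv]
  rfl

/-- `H¹_#` is invariant under linear bijections of cells, with the chain rule for gradients. -/
theorem MemH1Per.comp_equiv (he : Set.BijOn e Y.carrier Z.carrier) {w : Coord n → ℝ}
    {p : Coord n → Coord n} (h : Z.MemH1Per w p) :
    Y.MemH1Per (w ∘ e)
      fun y => ContinuousLinearMap.adjoint (e : Coord n →L[ℝ] Coord n) (p (e y)) := by
  obtain ⟨c, -, hct, hc⟩ := map_measure he
  obtain ⟨hw, hp, φ, hφ, hlim, hlim'⟩ := h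
  set A := ContinuousLinearMap.adjoint (e : Coord n →L[ℝ] Coord n) with hA
  have hc2 : c ^ (1 / 2 : ℝ) ≠ ⊤ := ENNReal.rpow_ne_top_of_nonneg (by norm_num) hct
  refine ⟨memLp_comp_equiv hct hc hw, A.comp_memLp' (memLp_comp_equiv hct hc hp),
    fun k => φ k ∘ e, fun k => ⟨(hφ k).1.comp e.contDiff, (hφ k).2.comp_equiv he⟩, ?_, ?_⟩
  · have h1 := ENNReal.Tendsto.const_mul (a := c ^ (1 / 2 : ℝ)) hlim (Or.inr hc2)
    rw [mul_zero] at h1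
    exact h1.congr fun k => (eLpNorm_comp_equiv hc fun z => φ k z - w z).symm
  · have h1 := ENNReal.Tendsto.const_mul (a := ENNReal.ofReal ‖A‖ * c ^ (1 / 2 : ℝ)) hlim'
      (Or.inr (ENNReal.mul_ne_top ENNReal.ofReal_ne_top hc2))
    rw [mul_zero] at h1
    refine tendsto_of_tendsto_of_tendsto_of_le_of_le tendsto_const_nhds h1
      (fun _ => zero_le) fun k => ?_
    dsimp only
    rw [mul_assoc, ← eLpNorm_comp_equiv hc fun z => gradient (φ k) z - p z]
    refine eLpNorm_le_mul_eLpNorm_of_ae_le_mul (ae_of_all _ fun y => ?_) _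
    rw [gradient_comp_equiv (hφ k).1, ← map_sub]
    exact A.le_opNorm _

theorem grad_eq_of_inner_eq {G : Matrix (Fin n) (Fin n) ℝ} (hG : G.PosDef) {p x : Coord n}
    (h : ∀ v : Coord n, inner G v x = ∑ i, v i * p i) : grad G p = x := by
  have h1 : G *ᵥ x = p := by
    ext i
    have := h (EuclideanSpace.single i 1)
    simpa [inner, Pi.single_apply, Matrix.mulVec, dotProduct] using this
  have h2 : G⁻¹ *ᵥ p.ofLp = x := by
    rw [← h1, Matrix.mulVec_mulVec, Matrix.nonsing_inv_mul _ ((Matrix.isUnit_iff_isUnit_det _).1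
      hG.isUnit), Matrix.one_mulVec]
  exact h2

/-- Gradients of corresponding functions correspond under an isometry `e` of constant metrics. -/
theorem grad_map {G G' : Matrix (Fin n) (Fin n) ℝ} (hG : G.PosDef) (hG' : G'.PosDef)
    (hiso : ∀ v w : Coord n, inner G' (e v) (e w) = inner G v w) (p : Coord n) :
    grad G' p = e (WithLp.toLp 2
      (grad G (ContinuousLinearMap.adjoint (e : Coord n →L[ℝ] Coord n) p))) := by
  refine grad_eq_of_inner_eq hG' fun v => ?_
  obtain ⟨u, rfl⟩ := e.surjective v
  rw [hiso, inner_grad hG]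
  have h := ContinuousLinearMap.adjoint_inner_right (e : Coord n →L[ℝ] Coord n) u p
  simpa [PiLp.inner_apply, mul_comm] using h

theorem adjoint_adjoint_symm (q : Coord n) :
    ContinuousLinearMap.adjoint (e : Coord n →L[ℝ] Coord n)
      (ContinuousLinearMap.adjoint (e.symm : Coord n →L[ℝ] Coord n) q) = q := by
  refine ext_inner_right ℝ fun v => ?_
  rw [ContinuousLinearMap.adjoint_inner_left, ContinuousLinearMap.adjoint_inner_left]
  simp

/-- The homogenized flux is equivariant under a linear bijection of cells that is an isometry of
the constant metrics and transports one material property to the other. -/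
theorem IsFlux.map {G G' : Matrix (Fin n) (Fin n) ℝ} {D D' : Coord n → ℝ} {v b : Coord n}
    (hD : Y.IsMaterial D) (hG : G.PosDef) (hG' : G'.PosDef)
    (he : Set.BijOn e Y.carrier Z.carrier) (hDD' : ∀ y ∈ Y.carrier, D' (e y) = D y)
    (hiso : ∀ v w : Coord n, inner G' (e v) (e w) = inner G v w)
    (h : Y.IsFlux D G v b) : Z.IsFlux D' G' (e v) (e b) := by
  obtain ⟨w, p, ⟨hwp, hsol⟩, hb⟩ := h
  obtain ⟨c, hc0, hct, hc⟩ := map_measure he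
  have hc' : c.toReal ≠ 0 := ENNReal.toReal_ne_zero.2 ⟨hc0, hct⟩
  set A' := ContinuousLinearMap.adjoint (e.symm : Coord n →L[ℝ] Coord n) with hA'
  have hint : ∀ f : Coord n → ℝ,
      ∫ z in Z.carrier, f z = c.toReal⁻¹ * ∫ y in Y.carrier, f (e y) := by
    intro f
    have h1 := e.toHomeomorph.measurableEmbedding.integral_map (μ := Y.measure) f
    have h2 : ⇑e.toHomeomorph = e := rfl
    rw [h2, hc, integral_smul_measure, smul_eq_mul] at h1
    rw [eq_inv_mul_iff_mul_eq₀ hc']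
    exact h1
  have hvol : volume.real Z.carrier = c.toReal⁻¹ * volume.real Y.carrier := by
    simpa using hint fun _ => 1
  have hgrad : ∀ q : Coord n, grad G' (A' q) = e (WithLp.toLp 2 (grad G q)) := fun q => by
    rw [grad_map hG hG' hiso, hA', adjoint_adjoint_symm]
  refine ⟨w ∘ e.symm, fun z => A' (p (e.symm z)), ⟨hwp.comp_equiv (bijOn_symm he), ?_⟩, ?_⟩
  · intro φ q hφ
    have h1 := hsol _ _ (hφ.comp_equiv he)
    rw [hint, hint, ← mul_neg]
    congr 1
    convert h1 using 1
    · refine setIntegral_congr_fun Y.measurableSet_carrier fun y hy => ?_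
      simp only [ContinuousLinearEquiv.symm_apply_apply]
      rw [hDD' y hy, hgrad, grad_map hG hG' hiso (q (e y)), hiso]
    · congr 1
      refine setIntegral_congr_fun Y.measurableSet_carrier fun y hy => ?_
      simp only
      rw [hDD' y hy, grad_map hG hG' hiso (q (e y)), hiso]
  · intro k
    rw [hint, hvol]
    have h1 : ∀ y ∈ Y.carrier, D' (e y) * (e v k + grad G' (A' (p (e.symm (e y)))) k) =
        ∑ j, e (EuclideanSpace.single j 1) k * (D y * (v j + grad G (p y) j)) := by
      intro y hy
      rw [hDD' y hy, e.symm_apply_apply, hgrad, ← PiLp.add_apply, ← map_add]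
      have := linearMap_apply_eq_sum (e : Coord n →ₗ[ℝ] Coord n)
        (v + WithLp.toLp 2 (grad G (p y))) k
      refine (congrArg (D y * ·) this).trans ?_
      simp only
      rw [Finset.mul_sum]
      refine Finset.sum_congr rfl fun j _ => ?_
      simp only [PiLp.add_apply, LinearEquiv.coe_coe, ContinuousLinearEquiv.coe_toLinearEquiv]
      ring
    have hfi : ∀ j, Integrable (fun y => D y * (v j + grad G (p y) j)) Y.measure := by
      intro j
      simp only [mul_add]
      exact (((memLp_of_continuous hD.1).integrable one_le_two).mul_const _).add
        (integrable_mul_grad hD hwp.2.1 j)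
    rw [setIntegral_congr_fun Y.measurableSet_carrier h1]
    have h2 := integral_finsetSum (μ := Y.measure) Finset.univ
      (f := fun j y => e (EuclideanSpace.single j 1) k * (D y * (v j + grad G (p y) j)))
      fun j _ => (hfi j).const_mul _
    have h3 := linearMap_apply_eq_sum (e : Coord n →ₗ[ℝ] Coord n) b k
    refine Eq.trans h3 ?_
    refine Eq.trans ?_ (congrArg (fun s => (c.toReal⁻¹ * volume.real Y.carrier)⁻¹ *
      (c.toReal⁻¹ * s)) h2.symm)
    simp only
    rw [← mul_assoc, Finset.mul_sum]
    refine Finset.sum_congr rfl fun j _ => ?_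
    rw [integral_const_mul, hb j]
    have hc3 : (c.toReal⁻¹ * volume.real Y.carrier)⁻¹ * c.toReal⁻¹ =
        (volume.real Y.carrier)⁻¹ := by
      rw [mul_inv, mul_right_comm, inv_mul_cancel₀ (inv_ne_zero hc'), one_mul]
    rw [hc3]
    simp only [LinearEquiv.coe_coe, ContinuousLinearEquiv.coe_toLinearEquiv]
    rw [mul_left_comm]
    rfl

end Cell

end Homogenization

/-! ### The effective operator in charts -/

namespace Homogenization

variable {n : ℕ} {H : Type*} [TopologicalSpace H] {I : ModelWithCorners ℝ (Coord n) H}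
  {M : Type*} [TopologicalSpace M] [ChartedSpace H M]

/-- The differential of a chart is invertible, at boundary points as well: the chart is defined on
an open set of `M`, so the chain rule applies to `φ⁻¹ ∘ φ = id` even if the domain of `φ⁻¹` is not
open. -/
theorem Atlas.exists_hasMFDerivAt {ι : Type*} [IsManifold I ∞ M] (𝒜 : Atlas I M ι) {α : ι} {x : M}
    (hx : x ∈ (𝒜.chart α).source) :
    ∃ L : TangentSpace I x ≃L[ℝ] Coord n,
      HasMFDerivAt I 𝓘(ℝ, Coord n) (𝒜.chart α) x (L : TangentSpace I x →L[ℝ] Coord n) := by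
  set φ := 𝒜.chart α with hφ
  have hs : φ.source ∈ 𝓝 x := (𝒜.isOpen_source α).mem_nhds hx
  have h1 : HasMFDerivAt I 𝓘(ℝ, Coord n) φ x (mfderiv I 𝓘(ℝ, Coord n) φ x) :=
    (((𝒜.smooth α).contMDiffAt hs).mdifferentiableAt (by simp)).hasMFDerivAt
  have h2 := (((𝒜.smooth_symm α) (φ x) (φ.map_source hx)).mdifferentiableWithinAt
    (by simp)).hasMFDerivWithinAt
  have h3 := h2.comp x (h1.hasMFDerivWithinAt (s := φ.source)) fun y hy => φ.map_source hy
  have h4 : HasMFDerivAt I I (φ.symm ∘ φ) x _ := h3.hasMFDerivAt hs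
  have h5 : HasMFDerivAt I I (φ.symm ∘ φ) x (ContinuousLinearMap.id ℝ (TangentSpace I x)) :=
    (hasMFDerivAt_id x).congr_of_eventuallyEq
      (Filter.eventually_of_mem hs fun y hy => φ.left_inv hy)
  have h6 := hasMFDerivAt_unique h4 h5
  let f : Coord n →L[ℝ] Coord n := mfderiv I 𝓘(ℝ, Coord n) φ x
  have hinj : Function.Injective f := by
    refine Function.LeftInverse.injective (g := fun v =>
      mfderivWithin 𝓘(ℝ, Coord n) I φ.symm φ.target (φ x) v) fun v => ?_
    exact DFunLike.congr_fun h6 v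
  exact ⟨(LinearEquiv.ofInjectiveEndo f.toLinearMap hinj).toContinuousLinearEquiv, h1⟩

/-- If a chart differs from `φ` by an affine map near `x`, its differential at `x` is that of `φ`
followed by the linear part. -/
theorem hasMFDerivAt_of_eq_affine {φ ψ : M → Coord n} {x : M}
    {L : TangentSpace I x ≃L[ℝ] Coord n}
    (hL : HasMFDerivAt I 𝓘(ℝ, Coord n) φ x (L : TangentSpace I x →L[ℝ] Coord n))
    (e : Coord n ≃L[ℝ] Coord n) (t : Coord n) (h : ∀ᶠ y in 𝓝 x, ψ y = e (φ y) + t) :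
    HasMFDerivAt I 𝓘(ℝ, Coord n) ψ x
      ((L.trans e : TangentSpace I x ≃L[ℝ] Coord n) : TangentSpace I x →L[ℝ] Coord n) := by
  have h1 : HasFDerivAt (fun z => e z + t) (e : Coord n →L[ℝ] Coord n) (φ x) :=
    e.hasFDerivAt.add_const t
  exact (h1.hasMFDerivAt.comp x hL).congr_of_eventuallyEq h

theorem basisVec_eq {φ : M → Coord n} {x : M} {L : TangentSpace I x ≃L[ℝ] Coord n}
    (hL : HasMFDerivAt I 𝓘(ℝ, Coord n) φ x (L : TangentSpace I x →L[ℝ] Coord n)) (i : Fin n) :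
    basisVec I φ x i = L.symm (EuclideanSpace.single i 1) := by
  have h1 : (mfderiv I 𝓘(ℝ, Coord n) φ x).inverse =
      (L.symm : Coord n →L[ℝ] TangentSpace I x) := by
    rw [hL.mfderiv]
    exact ContinuousLinearMap.inverse_equiv L
  exact DFunLike.congr_fun h1 _

variable [IsManifold I ∞ M]
  (g : ContMDiffRiemannianMetric I ∞ (Coord n) (fun x : M => TangentSpace I x))

/-- The coordinate metric `g_{ij}(x)` is the metric `g` at `x`, read through the differential of
the chart. -/
theorem inner_gram {φ : M → Coord n} {x : M} {L : TangentSpace I x ≃L[ℝ] Coord n}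
    (hL : HasMFDerivAt I 𝓘(ℝ, Coord n) φ x (L : TangentSpace I x →L[ℝ] Coord n))
    (v w : Coord n) :
    Cell.inner (gram g φ x) v w = g.inner x (L.symm v) (L.symm w) := by
  have hsum : ∀ v : Coord n, L.symm v = ∑ i, v i • L.symm (EuclideanSpace.single i 1) := by
    intro v
    conv_lhs => rw [← (EuclideanSpace.basisFun (Fin n) ℝ).sum_repr v]
    simp [map_sum]
  rw [hsum v, hsum w]
  simp only [Cell.inner, gram, Matrix.of_apply, basisVec_eq hL, map_sum, map_smul,
    sum_apply, smul_apply, smul_eq_mul, Finset.mul_sum]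
  refine Finset.sum_comm.trans (Finset.sum_congr rfl fun i _ => Finset.sum_congr rfl fun j _ => ?_)
  ring

theorem posDef_gram {φ : M → Coord n} {x : M} {L : TangentSpace I x ≃L[ℝ] Coord n}
    (hL : HasMFDerivAt I 𝓘(ℝ, Coord n) φ x (L : TangentSpace I x →L[ℝ] Coord n)) :
    (gram g φ x).PosDef := by
  refine Matrix.PosDef.of_dotProduct_mulVec_pos ?_ fun v hv => ?_
  · ext i j
    simp [gram, g.symm x (basisVec I φ x j)]
  · have h1 : star v ⬝ᵥ gram g φ x *ᵥ v = Cell.inner (gram g φ x) v v := by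
      simp only [dotProduct, Matrix.mulVec, Cell.inner, star_trivial, Finset.mul_sum]
      exact Finset.sum_congr rfl fun i _ => Finset.sum_congr rfl fun j _ => by ring
    have h2 := inner_gram g hL (WithLp.toLp 2 v) (WithLp.toLp 2 v)
    rw [h1]
    refine lt_of_lt_of_eq (g.pos x _ fun h => hv ?_) h2.symm
    have h3 : WithLp.toLp 2 v = 0 := by simpa using h
    simpa using h3

/-- The condition on the effective operator `T` in one chart says that `T` is the homogenized flux
map, transported to the tangent space by the differential of the chart. -/
theorem exists_effectiveCoeff_iff {φ : M → Coord n} {x : M} {L : TangentSpace I x ≃L[ℝ] Coord n}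
    (hL : HasMFDerivAt I 𝓘(ℝ, Coord n) φ x (L : TangentSpace I x →L[ℝ] Coord n))
    {Y : Cell n} {D : Coord n → ℝ} {B : Coord n →ₗ[ℝ] Coord n}
    (hB : ∀ v b, Y.IsFlux D (gram g φ x) v b ↔ b = B v)
    (T : TangentSpace I x →ₗ[ℝ] TangentSpace I x) :
    (∃ (w : Fin n → Coord n → ℝ) (p : Fin n → Coord n → Coord n),
      (∀ i, Y.IsCellSolution D (gram g φ x) i (w i) (p i)) ∧
      ∀ i, T (basisVec I φ x i) =
        ∑ k, Y.effectiveCoeff D (gram g φ x) p k i • basisVec I φ x k) ↔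
    ∀ v, T v = L.symm (B (L v)) := by
  have hsum : ∀ v : Coord n, ∑ k, v k • basisVec I φ x k = L.symm v := by
    intro v
    conv_rhs => rw [← (EuclideanSpace.basisFun (Fin n) ℝ).sum_repr v]
    simp [map_sum, basisVec_eq hL]
  have hcoeff : ∀ (p : Fin n → Coord n → Coord n) k i,
      Y.effectiveCoeff D (gram g φ x) p k i = (volume.real Y.carrier)⁻¹ * ∫ y in Y.carrier,
        D y * ((EuclideanSpace.single i (1 : ℝ) : Coord n) k + Cell.grad (gram g φ x) (p i y) k) := by
    intro p k i
    simp [Cell.effectiveCoeff]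
  constructor
  · rintro ⟨w, p, hsol, hT⟩
    have h1 : ∀ i, T (L.symm (EuclideanSpace.single i 1)) =
        L.symm (B (EuclideanSpace.single i 1)) := by
      intro i
      have h2 : Y.IsFlux D (gram g φ x) (EuclideanSpace.single i 1)
          (WithLp.toLp 2 fun k => Y.effectiveCoeff D (gram g φ x) p k i) :=
        ⟨w i, p i, hsol i, fun k => hcoeff p k i⟩
      rw [← (hB _ _).1 h2, ← basisVec_eq hL, hT, ← hsum]
    have h3 : T ∘ₗ L.symm.toLinearMap = L.symm.toLinearMap ∘ₗ B := by
      refine (EuclideanSpace.basisFun (Fin n) ℝ).toBasis.ext fun i => ?_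
      simpa using h1 i
    intro v
    have h4 := LinearMap.congr_fun h3 (L v)
    simpa using h4
  · intro hT
    choose w p hsol hb using fun i => (hB (EuclideanSpace.single i 1) _).2 rfl
    refine ⟨w, p, hsol, fun i => ?_⟩
    rw [hT, basisVec_eq hL, L.apply_symm_apply, ← hsum]
    refine Finset.sum_congr rfl fun k _ => ?_
    rw [hb, hcoeff]

/-- For an atlas that satisfies the UC-criterion, all charts around `x` have the same differential
at `x`, so one chart determines the effective operator. -/
theorem isEffectiveOperator_iff {ι : Type*} {𝒜 : Atlas I M ι} {Y : Cell n} {S : Set ℝ}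
    (hUC : 𝒜.IsUC Y S) (hS : S.Nonempty) {D : Coord n → ℝ} {x : M} {α : ι}
    (hx : x ∈ (𝒜.chart α).source) {L : TangentSpace I x ≃L[ℝ] Coord n}
    (hL : HasMFDerivAt I 𝓘(ℝ, Coord n) (𝒜.chart α) x (L : TangentSpace I x →L[ℝ] Coord n))
    {B : Coord n →ₗ[ℝ] Coord n}
    (hB : ∀ v b, Y.IsFlux D (gram g (𝒜.chart α) x) v b ↔ b = B v)
    (T : TangentSpace I x →ₗ[ℝ] TangentSpace I x) :
    IsEffectiveOperator g 𝒜 Y D x T ↔ ∀ v, T v = L.symm (B (L v)) := by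
  refine ⟨fun h => (exists_effectiveCoeff_iff g hL hB T).1 (h α hx), fun hT β hβ => ?_⟩
  obtain ⟨ε, hε⟩ := hS
  obtain ⟨k, hk⟩ := hUC β α ⟨x, hβ, hx⟩ ε hε
  have hnhds : (𝒜.chart β).source ∩ (𝒜.chart α).source ∈ 𝓝 x :=
    ((𝒜.isOpen_source β).inter (𝒜.isOpen_source α)).mem_nhds ⟨hβ, hx⟩
  have hL' : HasMFDerivAt I 𝓘(ℝ, Coord n) (𝒜.chart β) x
      (L : TangentSpace I x →L[ℝ] Coord n) :=
    hasMFDerivAt_of_eq_affine hL (ContinuousLinearEquiv.refl ℝ _) _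
      (Filter.eventually_of_mem hnhds hk)
  have hgram : gram g (𝒜.chart β) x = gram g (𝒜.chart α) x := by
    ext i j
    simp only [gram, Matrix.of_apply, basisVec_eq hL, basisVec_eq hL']
  exact (exists_effectiveCoeff_iff g hL' (hgram ▸ hB) T).2 hT

end Homogenization

theorem theorem4p2
    {n : ℕ} {H : Type*} [TopologicalSpace H] (I : ModelWithCorners ℝ (Coord n) H)
    {M : Type*} [TopologicalSpace M] [ChartedSpace H M] [IsManifold I ∞ M]
    [CompactSpace M] [T2Space M] [MeasurableSpace M] [BorelSpace M]
    (g : ContMDiffRiemannianMetric I ∞ (Coord n) (fun x : M => TangentSpace I x))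
    {ι₁ ι₂ : Type*} [Finite ι₁] [Finite ι₂]
    (𝒜₁ : Atlas I M ι₁) (𝒜₂ : Atlas I M ι₂)
    (Y Z : Cell n) (S : Set ℝ) (hS : ∀ ε ∈ S, 0 < ε) (hS₀ : (0 : ℝ) ∈ closure S)
    (hUC₁ : 𝒜₁.IsUC Y S) (hUC₂ : 𝒜₂.IsUC Z S)
    (D_Y D_Z : Coord n → ℝ) (hD_Y : Y.IsMaterial D_Y) (hD_Z : Z.IsMaterial D_Z)
    (F : Coord n →ₗ[ℝ] Coord n)
    (hF : ∀ α β, ∃ t : Coord n, ∀ x ∈ (𝒜₁.chart α).source ∩ (𝒜₂.chart β).source,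
      𝒜₂.chart β x = F (𝒜₁.chart α x) + t)
    (hFcell : Set.BijOn F Y.carrier Z.carrier)
    (hFD : ∀ y ∈ Y.carrier, D_Z (F y) = D_Y y) :
    (∃ B : ∀ x : M, TangentSpace I x →ₗ[ℝ] TangentSpace I x,
      ∀ (x : M) (T : TangentSpace I x →ₗ[ℝ] TangentSpace I x),
        (IsEffectiveOperator g 𝒜₁ Y D_Y x T ↔ T = B x) ∧
        (IsEffectiveOperator g 𝒜₂ Z D_Z x T ↔ T = B x)) ∧
    ∀ (c : ℝ) (f u : M → ℝ), 0 ≤ c → MemLp f 2 (riemannianVolume g) →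
      (IsLimitSolution g 𝒜₁ Y D_Y c f u ↔ IsLimitSolution g 𝒜₂ Z D_Z c f u) := by
  have hS₁ : S.Nonempty := closure_nonempty_iff.1 ⟨0, hS₀⟩
  have hFbij : Function.Bijective F :=
    have h := Cell.surjective_of_surjOn hFcell.surjOn
    ⟨LinearMap.injective_iff_surjective.2 h, h⟩
  let e : Coord n ≃L[ℝ] Coord n := (LinearEquiv.ofBijective F hFbij).toContinuousLinearEquiv
  have hpt : ∀ x : M, ∃ B : TangentSpace I x →ₗ[ℝ] TangentSpace I x,
      ∀ T : TangentSpace I x →ₗ[ℝ] TangentSpace I x,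
        (IsEffectiveOperator g 𝒜₁ Y D_Y x T ↔ T = B) ∧
        (IsEffectiveOperator g 𝒜₂ Z D_Z x T ↔ T = B) := by
    intro x
    obtain ⟨α, hα⟩ := 𝒜₁.cover x
    obtain ⟨β, hβ⟩ := 𝒜₂.cover x
    obtain ⟨L, hL⟩ := 𝒜₁.exists_hasMFDerivAt hα
    obtain ⟨t, ht⟩ := hF α β
    have hL' : HasMFDerivAt I 𝓘(ℝ, Coord n) (𝒜₂.chart β) x
        ((L.trans e : TangentSpace I x ≃L[ℝ] Coord n) : TangentSpace I x →L[ℝ] Coord n) :=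
      hasMFDerivAt_of_eq_affine hL e t (Filter.eventually_of_mem
        (((𝒜₁.isOpen_source α).inter (𝒜₂.isOpen_source β)).mem_nhds ⟨hα, hβ⟩) ht)
    have hG := posDef_gram g hL
    have hG' := posDef_gram g hL'
    obtain ⟨B, hB⟩ := Cell.exists_linearMap_isFlux_iff hD_Y hG
    obtain ⟨B', hB'⟩ := Cell.exists_linearMap_isFlux_iff hD_Z hG'
    -- The differential `e` of the change of charts is an isometry of the two coordinate metrics.
    have hconj : ∀ v, B' (e v) = e (B v) := fun v =>
      ((hB' _ _).1 (((hB v _).2 rfl).map hD_Y hG hG' hFcell hFD fun v w => by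
        rw [inner_gram g hL, inner_gram g hL']
        simp)).symm
    refine ⟨L.symm.toLinearMap ∘ₗ B ∘ₗ L.toLinearMap, fun T => ⟨?_, ?_⟩⟩
    · rw [isEffectiveOperator_iff g hUC₁ hS₁ hα hL hB, LinearMap.ext_iff]
      rfl
    · rw [isEffectiveOperator_iff g hUC₂ hS₁ hβ hL' hB', LinearMap.ext_iff]
      refine forall_congr' fun v => ?_
      simp [hconj]
  choose B hB using hpt
  refine ⟨⟨B, hB⟩, fun c f u _ _ => ?_⟩
  have heq : ∀ x T, IsEffectiveOperator g 𝒜₁ Y D_Y x T ↔ IsEffectiveOperator g 𝒜₂ Z D_Z x T :=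
    fun x T => (hB x T).1.trans (hB x T).2.symm
  simp only [IsLimitSolution, heq]
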